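/- Let $M$ be a smooth manifold of dimension $2n+1$ with an almost (para)contact metric structure $(\varphi,\xi,\eta,g)$ with signs $\varepsilon_0,\varepsilon_1\in\{1,-1\}$: smooth tensor fields, namely a $(1,1)$-tensor field $\varphi$, a vector field $\xi$, a $1$-form $\eta$ and a Riemannian or pseudo-Riemannian metric $g$, such that $$\varphi^2X=\varepsilon_1(X-\eta(X)\xi),\qquad \eta(\xi)=1,\qquad g(\varphi X,\varphi Y)=-\varepsilon_1\bigl(g(X,Y)-\varepsilon_0\,\eta(X)\eta(Y)\bigr).$$ Assume that the structure is (para)contact metric, i.e. $d\eta(X,Y)=g(X,\varphi Y)$, where $d\eta(X,Y)=\frac12\bigl(X\eta(Y)-Y\eta(X)-\eta([X,Y])\bigr)$. Let $\nabla$ be the Levi-Civita connection of $g$, $R(X,Y)=[\nabla_X,\nabla_Y]-\nabla_{[X,Y]}$, $\mathrm{Ric}(Y,Z)=\mathrm{Tr}\{X\mapsto R(X,Y)Z\}$, $h=\frac12\mathcal L_\xi\varphi$, and, for an orthonormal frame $(E_i)$ with $\epsilon_i=g(E_i,E_i)$, $$r=\sum_i\epsilon_i\,\mathrm{Ric}(E_i,E_i),\qquad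 \mathrm{Ric}^*(X,Y)=\sum_i\epsilon_i\,g\bigl(R(X,E_i)\varphi E_i,\varphi Y\bigr),\qquad r^*=\sum_i\epsilon_i\,\mathrm{Ric}^*(E_i,E_i),$$ $$|h|^2=\sum_i\epsilon_i\,g(hE_i,hE_i),\qquad \mathrm{Tr}(\nabla\varphi)^2=\sum_{i,j}\epsilon_i\epsilon_j\,g\bigl((\nabla_{E_i}\varphi)E_j,(\nabla_{E_i}\varphi)E_j\bigr).$$ Then at every point of $M$ $$\mathrm{Ric}(\xi,\xi)=-\varepsilon_1\bigl(2n-|h|^2\bigr)$$ and $$\varepsilon_0\,(r^*+\varepsilon_1 r)+4n^2=\mathrm{Tr}\,h^2+\tfrac12\bigl(\varepsilon_0\,\mathrm{Tr}(\nabla\varphi)^2-4n\bigr).$$ In particular, for $\varepsilon_0=1$ one has $r^*+\varepsilon_1 r+4n^2=\mathrm{Tr}\,h^2+\frac12(\mathrm{Tr}(\nabla\varphi)^2-4n)$. -/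

import Mathlib

open scoped Manifold ContDiff
open Bundle

namespace Paracontact

noncomputable section

/-! ## Tensor calculus on a finite-dimensional real vector space

A vector field is a map `ξ : E → E`, a `1`-form is `η : E → (E →L[ℝ] ℝ)`, a `(1,1)`-tensor field is
`φ : E → (E →L[ℝ] E)` and a (pseudo-)Riemannian metric is `g : E → (E →L[ℝ] E →L[ℝ] ℝ)`.
Since these objects are written in linear coordinates, partial derivatives are given by `fderiv`. -/

section Local

variable {E : Type*} [NormedAddCommGroup E] [NormedSpace ℝ E]

/-- Exterior derivative of a `1`-form, with the normalization
`dη(X, Y) = ½ (X η(Y) - Y η(X) - η([X, Y]))`: in coordinates `½ (∂ᵢ ηⱼ - ∂ⱼ ηᵢ)`. -/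
def extDer (η : E → (E →L[ℝ] ℝ)) (p u v : E) : ℝ :=
  (1 / 2 : ℝ) * (fderiv ℝ η p u v - fderiv ℝ η p v u)

/-- Lie derivative `L_ξ φ` of a `(1,1)`-tensor field: `(L_ξ φ) v = [ξ, φ v] - φ [ξ, v]`, in
coordinates `(∂_ξ φ) v - (Dξ) (φ v) + φ ((Dξ) v)`. -/
def lieDer (ξ : E → E) (φ : E → (E →L[ℝ] E)) (p : E) : E →L[ℝ] E :=
  fderiv ℝ φ p (ξ p) - (fderiv ℝ ξ p).comp (φ p) + (φ p).comp (fderiv ℝ ξ p)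

/-- Christoffel symbols of the first kind, as a `1`-form in the last argument:
`w ↦ ½ ((∂_u g)(v, w) + (∂_v g)(u, w) - (∂_w g)(u, v))`. -/
def christoffelFirst (g : E → (E →L[ℝ] E →L[ℝ] ℝ)) (p u v : E) : E →L[ℝ] ℝ :=
  (1 / 2 : ℝ) • (fderiv ℝ g p u v + fderiv ℝ g p v u - ((fderiv ℝ g p).flip u).flip v)

theorem christoffelFirst_apply (g : E → (E →L[ℝ] E →L[ℝ] ℝ)) (p u v w : E) :
    christoffelFirst g p u v w =
      (1 / 2 : ℝ) * (fderiv ℝ g p u v w + fderiv ℝ g p v u w - fderiv ℝ g p w u v) := rfl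

/-- Christoffel symbols `Γ_p(u, v)` of the Levi-Civita connection of `g`, so that
`∇_X Y = ∂_X Y + Γ(X, Y)`. They are obtained from those of the first kind by raising an index with
the inverse of the isomorphism `u ↦ g_p(u, ·)`. -/
def christoffel (g : E → (E →L[ℝ] E →L[ℝ] ℝ)) (p u v : E) : E :=
  (g p).inverse (christoffelFirst g p u v)

/-- Covariant derivative `(∇_u φ) v = (∂_u φ) v + Γ(u, φ v) - φ (Γ(u, v))` of a `(1,1)`-tensor
field with respect to the Levi-Civita connection of `g`. -/
def covDer (g : E → (E →L[ℝ] E →L[ℝ] ℝ)) (φ : E → (E →L[ℝ] E)) (p u v : E) : E :=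
  fderiv ℝ φ p u v + christoffel g p u (φ p v) - φ p (christoffel g p u v)

/-- Riemann curvature operator `R(u, v) = [∇_u, ∇_v] - ∇_[u, v]`: in coordinates
`R(u, v) w = (∂_u Γ)(v, w) - (∂_v Γ)(u, w) + Γ(u, Γ(v, w)) - Γ(v, Γ(u, w))`. -/
def riemann (g : E → (E →L[ℝ] E →L[ℝ] ℝ)) (p u v w : E) : E :=
  fderiv ℝ (fun q => christoffel g q v w) p u - fderiv ℝ (fun q => christoffel g q u w) p v +
    christoffel g p u (christoffel g p v w) - christoffel g p v (christoffel g p u w)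

variable [FiniteDimensional ℝ E]

/-- Ricci tensor `Ric(v, w) = Tr {u ↦ R(u, v) w}`, the trace being the sum `∑ bⁱ(R(bᵢ, v) w)` over
a basis `bᵢ` with dual basis `bⁱ`. -/
def ricci (g : E → (E →L[ℝ] E →L[ℝ] ℝ)) (p v w : E) : ℝ :=
  ∑ i, (Module.finBasis ℝ E).coord i (riemann g p (Module.finBasis ℝ E i) v w)

/-- Trace `Tr_G β = ∑ Gⁱʲ β(bᵢ, bⱼ)` of a bilinear form `β` with respect to a nondegenerate
symmetric form `G`; here `bᵢ` is a basis with dual basis `bⁱ`, and `∑ⱼ Gⁱʲ bⱼ` is the vector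
`G⁻¹ bⁱ`. For a `G`-orthonormal basis `eᵢ` this is `∑ G(eᵢ, eᵢ) β(eᵢ, eᵢ)`. -/
def metricTrace (G : E →L[ℝ] E →L[ℝ] ℝ) (β : E → E → ℝ) : ℝ :=
  ∑ i, β (Module.finBasis ℝ E i)
    (G.inverse (LinearMap.toContinuousLinearMap ((Module.finBasis ℝ E).coord i)))

/-- Scalar curvature `r = Tr_g Ric`. -/
def scalarCurv (g : E → (E →L[ℝ] E →L[ℝ] ℝ)) (p : E) : ℝ :=
  metricTrace (g p) (ricci g p)

/-- `*`-Ricci tensor `Ric*(u, v) = ∑ εᵢ g(R(u, eᵢ) φ eᵢ, φ v)`. -/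
def starRicci (g : E → (E →L[ℝ] E →L[ℝ] ℝ)) (φ : E → (E →L[ℝ] E)) (p u v : E) : ℝ :=
  metricTrace (g p) (fun a b => g p (riemann g p u a (φ p b)) (φ p v))

/-- `*`-scalar curvature `r* = Tr_g Ric*`. -/
def starScalarCurv (g : E → (E →L[ℝ] E →L[ℝ] ℝ)) (φ : E → (E →L[ℝ] E)) (p : E) : ℝ :=
  metricTrace (g p) (starRicci g φ p)

/-- `|h|² = ∑ εᵢ g(h eᵢ, h eᵢ)` for an endomorphism `h`. -/
def normSqEnd (G : E →L[ℝ] E →L[ℝ] ℝ) (h : E →L[ℝ] E) : ℝ :=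
  metricTrace G (fun u v => G (h u) (h v))

/-- `Tr (∇φ)² = ∑ᵢⱼ εᵢ εⱼ g((∇_{eᵢ} φ) eⱼ, (∇_{eᵢ} φ) eⱼ)`. -/
def traceCovDerSq (g : E → (E →L[ℝ] E →L[ℝ] ℝ)) (φ : E → (E →L[ℝ] E)) (p : E) : ℝ :=
  metricTrace (g p) fun u v => metricTrace (g p) fun a b =>
    g p (covDer g φ p u a) (covDer g φ p v b)

end Local

/-! ## Tensor fields on a manifold and their coordinate expressions -/

section Coordinates

variable {E : Type*} [NormedAddCommGroup E] [NormedSpace ℝ E]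
  {M : Type*} [TopologicalSpace M] [ChartedSpace E M]

/-- The differential at the point with coordinates `p` of the inverse of the chart at `x₀`. -/
def chartPull (x₀ : M) (p : E) :
    E →L[ℝ] TangentSpace 𝓘(ℝ, E) ((extChartAt 𝓘(ℝ, E) x₀).symm p) :=
  mfderiv 𝓘(ℝ, E) 𝓘(ℝ, E) (extChartAt 𝓘(ℝ, E) x₀).symm p

/-- The differential at the point with coordinates `p` of the chart at `x₀`. -/
def chartPush (x₀ : M) (p : E) :
    TangentSpace 𝓘(ℝ, E) ((extChartAt 𝓘(ℝ, E) x₀).symm p) →L[ℝ] E :=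
  mfderiv 𝓘(ℝ, E) 𝓘(ℝ, E) (extChartAt 𝓘(ℝ, E) x₀) ((extChartAt 𝓘(ℝ, E) x₀).symm p)

/-- Coordinate expression of a vector field in the chart at `x₀`. -/
def coordVec (x₀ : M) (ξ : ∀ x : M, TangentSpace 𝓘(ℝ, E) x) (p : E) : E :=
  chartPush x₀ p (ξ ((extChartAt 𝓘(ℝ, E) x₀).symm p))

/-- Coordinate expression of a `1`-form in the chart at `x₀`. -/
def coordForm (x₀ : M) (η : ∀ x : M, TangentSpace 𝓘(ℝ, E) x →L[ℝ] ℝ) (p : E) : E →L[ℝ] ℝ :=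
  (η ((extChartAt 𝓘(ℝ, E) x₀).symm p)).comp (chartPull x₀ p)

/-- Coordinate expression of a `(1,1)`-tensor field in the chart at `x₀`. -/
def coordEnd (x₀ : M) (φ : ∀ x : M, TangentSpace 𝓘(ℝ, E) x →L[ℝ] TangentSpace 𝓘(ℝ, E) x)
    (p : E) : E →L[ℝ] E :=
  (chartPush x₀ p).comp ((φ ((extChartAt 𝓘(ℝ, E) x₀).symm p)).comp (chartPull x₀ p))

/-- Coordinate expression of a `(0,2)`-tensor field in the chart at `x₀`. -/
def coordBilin (x₀ : M)
    (g : ∀ x : M, TangentSpace 𝓘(ℝ, E) x →L[ℝ] TangentSpace 𝓘(ℝ, E) x →L[ℝ] ℝ)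
    (p : E) : E →L[ℝ] E →L[ℝ] ℝ :=
  ContinuousLinearMap.bilinearComp
    (show E →L[ℝ] E →L[ℝ] ℝ from g ((extChartAt 𝓘(ℝ, E) x₀).symm p))
    (chartPull x₀ p : E →L[ℝ] E) (chartPull x₀ p : E →L[ℝ] E)

theorem coordBilin_apply (x₀ : M)
    (g : ∀ x : M, TangentSpace 𝓘(ℝ, E) x →L[ℝ] TangentSpace 𝓘(ℝ, E) x →L[ℝ] ℝ) (p u v : E) :
    coordBilin x₀ g p u v =
      g ((extChartAt 𝓘(ℝ, E) x₀).symm p) (chartPull x₀ p u) (chartPull x₀ p v) := rfl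

end Coordinates

/-! ## Almost (para)contact metric structures -/

/-- An almost (para)contact metric structure `(φ, ξ, η, g)` with signs `ε₀, ε₁ = ±1` on a smooth
manifold `M` modelled on `E` (without boundary). All tensor fields are smooth; `g` is a
(pseudo-)Riemannian metric of arbitrary signature. -/
structure AlmostParacontactMetric (E : Type*) [NormedAddCommGroup E] [NormedSpace ℝ E]
    (M : Type*) [TopologicalSpace M] [ChartedSpace E M] [IsManifold 𝓘(ℝ, E) ∞ M]
    (ε₀ ε₁ : ℝ) where
  φ : ∀ x : M, TangentSpace 𝓘(ℝ, E) x →L[ℝ] TangentSpace 𝓘(ℝ, E) x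
  ξ : ∀ x : M, TangentSpace 𝓘(ℝ, E) x
  η : ∀ x : M, TangentSpace 𝓘(ℝ, E) x →L[ℝ] ℝ
  g : ∀ x : M, TangentSpace 𝓘(ℝ, E) x →L[ℝ] TangentSpace 𝓘(ℝ, E) x →L[ℝ] ℝ
  smooth_φ : ContMDiff 𝓘(ℝ, E) (𝓘(ℝ, E).prod 𝓘(ℝ, E →L[ℝ] E)) ∞
    (fun x => (⟨x, φ x⟩ : TotalSpace (E →L[ℝ] E)
      (fun x : M => TangentSpace 𝓘(ℝ, E) x →L[ℝ] TangentSpace 𝓘(ℝ, E) x)))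
  smooth_ξ : ContMDiff 𝓘(ℝ, E) (𝓘(ℝ, E).prod 𝓘(ℝ, E)) ∞
    (fun x => (⟨x, ξ x⟩ : TotalSpace E (fun x : M => TangentSpace 𝓘(ℝ, E) x)))
  smooth_η : ContMDiff 𝓘(ℝ, E) (𝓘(ℝ, E).prod 𝓘(ℝ, E →L[ℝ] ℝ)) ∞
    (fun x => (⟨x, η x⟩ : TotalSpace (E →L[ℝ] ℝ)
      (fun x : M => TangentSpace 𝓘(ℝ, E) x →L[ℝ] ℝ)))
  smooth_g : ContMDiff 𝓘(ℝ, E) (𝓘(ℝ, E).prod 𝓘(ℝ, E →L[ℝ] E →L[ℝ] ℝ)) ∞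
    (fun x => (⟨x, g x⟩ : TotalSpace (E →L[ℝ] E →L[ℝ] ℝ)
      (fun x : M => TangentSpace 𝓘(ℝ, E) x →L[ℝ] TangentSpace 𝓘(ℝ, E) x →L[ℝ] ℝ)))
  ε₀_sign : ε₀ = 1 ∨ ε₀ = -1
  ε₁_sign : ε₁ = 1 ∨ ε₁ = -1
  g_symm : ∀ (x : M) (u v : TangentSpace 𝓘(ℝ, E) x), g x u v = g x v u
  g_nondeg : ∀ (x : M) (u : TangentSpace 𝓘(ℝ, E) x), (∀ v, g x u v = 0) → u = 0
  φ_sq : ∀ (x : M) (u : TangentSpace 𝓘(ℝ, E) x), φ x (φ x u) = ε₁ • (u - η x u • ξ x)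
  η_ξ : ∀ x : M, η x (ξ x) = 1
  g_φ : ∀ (x : M) (u v : TangentSpace 𝓘(ℝ, E) x),
    g x (φ x u) (φ x v) = -ε₁ * (g x u v - ε₀ * (η x u * η x v))

namespace AlmostParacontactMetric

variable {E : Type*} [NormedAddCommGroup E] [NormedSpace ℝ E]
  {M : Type*} [TopologicalSpace M] [ChartedSpace E M] [IsManifold 𝓘(ℝ, E) ∞ M]
  {ε₀ ε₁ : ℝ}

/-- The structure is (para)contact metric if `dη = Φ`, where `Φ(X, Y) = g(X, φ Y)`. The equality of
these two `2`-forms is expressed at every point of every chart `chartAt x₀` of `M`. -/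
def IsParacontactMetric (S : AlmostParacontactMetric E M ε₀ ε₁) : Prop :=
  ∀ x₀ : M, ∀ p ∈ (extChartAt 𝓘(ℝ, E) x₀).target, ∀ u v : E,
    extDer (coordForm x₀ S.η) p u v = coordBilin x₀ S.g p u (coordEnd x₀ S.φ p v)

/-! The following quantities at `x` are computed in the chart at `x`; they are values at `x` of
tensor fields (or of complete contractions of tensor fields), hence do not depend on the chart. -/

/-- `h = ½ L_ξ φ` at the point `x`. -/
def h (S : AlmostParacontactMetric E M ε₀ ε₁) (x : M) : E →L[ℝ] E :=
  (1 / 2 : ℝ) • lieDer (coordVec x S.ξ) (coordEnd x S.φ) (extChartAt 𝓘(ℝ, E) x x)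

/-- `Tr h²` at the point `x`. -/
def traceHSq (S : AlmostParacontactMetric E M ε₀ ε₁) (x : M) : ℝ :=
  LinearMap.trace ℝ E ((S.h x).comp (S.h x) : E →L[ℝ] E)

variable [FiniteDimensional ℝ E]

/-- `Ric(ξ, ξ)` at the point `x`. -/
def ricciXi (S : AlmostParacontactMetric E M ε₀ ε₁) (x : M) : ℝ :=
  ricci (coordBilin x S.g) (extChartAt 𝓘(ℝ, E) x x)
    (coordVec x S.ξ (extChartAt 𝓘(ℝ, E) x x)) (coordVec x S.ξ (extChartAt 𝓘(ℝ, E) x x))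

/-- `|h|²` at the point `x`. -/
def normHSq (S : AlmostParacontactMetric E M ε₀ ε₁) (x : M) : ℝ :=
  normSqEnd (coordBilin x S.g (extChartAt 𝓘(ℝ, E) x x)) (S.h x)

/-- The scalar curvature `r` at the point `x`. -/
def scalar (S : AlmostParacontactMetric E M ε₀ ε₁) (x : M) : ℝ :=
  scalarCurv (coordBilin x S.g) (extChartAt 𝓘(ℝ, E) x x)

/-- The `*`-scalar curvature `r*` at the point `x`. -/
def starScalar (S : AlmostParacontactMetric E M ε₀ ε₁) (x : M) : ℝ :=
  starScalarCurv (coordBilin x S.g) (coordEnd x S.φ) (extChartAt 𝓘(ℝ, E) x x)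

/-- `Tr (∇φ)²` at the point `x`. -/
def traceNablaPhiSq (S : AlmostParacontactMetric E M ε₀ ε₁) (x : M) : ℝ :=
  traceCovDerSq (coordBilin x S.g) (coordEnd x S.φ) (extChartAt 𝓘(ℝ, E) x x)

end AlmostParacontactMetric

end

end Paracontact

/-! Write A = ∇ξ, C = ∇φ, m = 2n, and take traces over a basis and its metric dual, which avoids
orthonormal frames and works in any signature. Differentiating the structure equations once gives
pointwise relations. The skew part of A is -ε₀φ, so S = A + ε₀φ is symmetric. The identity d(dη) = 0
makes g((∇_uφ)v, w) have vanishing cyclic sum. With ξ in one slot this gives ∇_ξφ = -Sφ - φS. Since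
∇_ξφ anticommutes with φ, it follows that Sφ = -φS. Hence h = φS, A² = φ² - ε₁h² on the tangent
space, and h is self-adjoint, so that |h|² = Tr h². For Ric(ξ,ξ), the Ricci identity for ξ with Aξ =
0 gives R(u,ξ)ξ = -A²u - (∇_ξA)u. Since Tr A = 0 near the point, the last term has no trace, so
Ric(ξ,ξ) = -Tr A² (`trace_A_sq`). For r* + ε₁r, the Ricci identity for φ expresses R(u,v)φw -
φR(u,v)w through ∇²φ. Its double trace needs only the derivatives of two first-order traces:
Σ(∇_{b_i}φ)c_i = -ε₁mξ (`sum_C`) and Σ(∇_{b_i}φ)φc_i = 0 (`sum_C_φ`). The first yields the term in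
m². The second yields a mixed contraction of ∇φ with itself, equal to half of Tr(∇φ)² by
`contraction_of_cyclic`. `scalar_add` collects these terms, and substituting Ric(ξ,ξ) gives the
second formula. -/

namespace Paracontact

/-! ## Metric traces -/

section DualPair

variable {E : Type*} [NormedAddCommGroup E] [NormedSpace ℝ E] {ι : Type*} [Fintype ι]
  {V : Type*} [AddCommGroup V] [Module ℝ V]

/-- Two families `b`, `c` dual to each other with respect to the symmetric form `G`. -/
structure IsDualPair (G : E →L[ℝ] E →L[ℝ] ℝ) (b c : ι → E) : Prop where
  symm : ∀ u v, G u v = G v u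
  sum_left : ∀ v, ∑ i, G v (c i) • b i = v
  sum_right : ∀ v, ∑ i, G v (b i) • c i = v

/-- A map of two variables linear in each of them. -/
structure IsBilin (β : E → E → V) : Prop where
  left : ∀ y, IsLinearMap ℝ fun x => β x y
  right : ∀ x, IsLinearMap ℝ fun y => β x y

theorem isLinearMap_map_sum_smul {f : E → V} (hf : IsLinearMap ℝ f) (a : ι → ℝ) (x : ι → E) :
    f (∑ i, a i • x i) = ∑ i, a i • f (x i) := by
  have h := map_sum (hf.mk' f) (fun i => a i • x i) Finset.univ
  simp only [map_smul] at h
  exact h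

namespace IsDualPair

variable {G : E →L[ℝ] E →L[ℝ] ℝ} {b c : ι → E} (H : IsDualPair G b c)
include H

theorem swap : IsDualPair G c b := ⟨H.symm, H.sum_right, H.sum_left⟩

theorem sum_apply_left {f : E → V} (hf : IsLinearMap ℝ f) (v : E) :
    ∑ i, G v (c i) • f (b i) = f v := by
  rw [← isLinearMap_map_sum_smul hf, H.sum_left]

theorem sum_mul (u v : E) : ∑ i, G u (b i) * G (c i) v = G u v := by
  have := H.swap.sum_apply_left (f := fun x => G x v) ⟨by simp, by simp⟩ u
  simpa using this

theorem nondeg {u : E} (hu : ∀ v, G u v = 0) : u = 0 := by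
  rw [← H.sum_left u]; simp [hu]

theorem ext {u v : E} (huv : ∀ w, G u w = G v w) : u = v := by
  rw [← sub_eq_zero]; exact H.nondeg fun w => by simp [huv]

/-- Expanding `T (b i)` in `b` and `T' (c i)` in `c` produces the same double sum. Values in `V`
allow vector-valued traces such as the divergence of `φ`. -/
theorem trace_adjoint {β : E → E → V} (hβ : IsBilin β) {T T' : E → E}
    (hT : ∀ x y, G (T x) y = G x (T' y)) :
    ∑ i, β (T (b i)) (c i) = ∑ i, β (b i) (T' (c i)) := by
  have h1 : ∀ i, β (T (b i)) (c i) = ∑ j, G (T (b i)) (c j) • β (b j) (c i) := fun i =>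
    (H.sum_apply_left (hβ.left (c i)) _).symm
  have h2 : ∀ i, β (b i) (T' (c i)) = ∑ j, G (T' (c i)) (b j) • β (b i) (c j) := fun i =>
    (H.swap.sum_apply_left (hβ.right (b i)) _).symm
  simp only [h1, h2]
  rw [Finset.sum_comm]
  refine Finset.sum_congr rfl fun j _ => Finset.sum_congr rfl fun i _ => ?_
  rw [hT, H.symm]

/-- Both sums are the contraction of `β` on the family `c` with the symmetric Gram matrix of `b`. -/
theorem trace_swap {β : E → E → V} (hβ : IsBilin β) :
    ∑ i, β (b i) (c i) = ∑ i, β (c i) (b i) := by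
  have h1 : ∀ i, β (b i) (c i) = ∑ j, G (b i) (b j) • β (c j) (c i) := fun i =>
    (H.swap.sum_apply_left (hβ.left (c i)) _).symm
  have h2 : ∀ i, β (c i) (b i) = ∑ j, G (b i) (b j) • β (c i) (c j) := fun i =>
    (H.swap.sum_apply_left (hβ.right (c i)) _).symm
  simp only [h1, h2]
  rw [Finset.sum_comm]
  refine Finset.sum_congr rfl fun j _ => Finset.sum_congr rfl fun i _ => ?_
  rw [H.symm]

/-- Cyclicity of the trace. -/
theorem trace_comm (S T : E →L[ℝ] E) :
    ∑ i, G (S (T (b i))) (c i) = ∑ i, G (T (S (b i))) (c i) := by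
  have h1 : ∀ i, G (S (T (b i))) (c i) = ∑ j, G (T (b i)) (c j) • G (S (b j)) (c i) := fun i =>
    (H.sum_apply_left (f := fun x => G (S x) (c i)) ⟨by simp, by simp⟩ _).symm
  have h2 : ∀ i, G (T (S (b i))) (c i) = ∑ j, G (S (b i)) (c j) • G (T (b j)) (c i) := fun i =>
    (H.sum_apply_left (f := fun x => G (T x) (c i)) ⟨by simp, by simp⟩ _).symm
  simp only [h1, h2]
  rw [Finset.sum_comm]
  refine Finset.sum_congr rfl fun j _ => Finset.sum_congr rfl fun i _ => ?_
  simp only [smul_eq_mul]; ring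

/-- For a cyclic trilinear form that is skew in the last two arguments, the two complete
contractions of its square are proportional. -/
theorem contraction_of_cyclic {C : E →L[ℝ] E →L[ℝ] E}
    (hskew : ∀ u v w, G (C u v) w = -G v (C u w))
    (hcyc : ∀ u v w, G u (C w v) + G v (C u w) + G w (C v u) = 0) :
    ∑ i, ∑ j, G (C (b i) (b j)) (C (c i) (c j)) =
      2 * ∑ i, ∑ j, G (C (b i) (b j)) (C (c j) (c i)) := by
  have e : ∀ x y, G x y = ∑ k, G x (b k) * G (c k) y := fun x y => (H.sum_mul x y).symm
  have h1 : ∑ i, ∑ j, G (C (b i) (b j)) (C (c i) (c j)) =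
      ∑ i, ∑ j, ∑ k, G (C (b i) (b j)) (b k) * G (c k) (C (c i) (c j)) :=
    Finset.sum_congr rfl fun i _ => Finset.sum_congr rfl fun j _ => e _ _
  have h2 : ∑ i, ∑ j, G (C (b i) (b j)) (C (c j) (c i)) =
      ∑ i, ∑ j, ∑ k, G (C (b i) (b j)) (b k) * G (c k) (C (c j) (c i)) :=
    Finset.sum_congr rfl fun i _ => Finset.sum_congr rfl fun j _ => e _ _
  -- Exchange the names `j` and `k`: skewness in the last two slots changes the sign of both
  -- factors.
  have h3 : ∑ i, ∑ j, ∑ k, G (C (b i) (b j)) (b k) * G (c k) (C (c j) (c i)) =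
      ∑ i, ∑ j, ∑ k, G (C (b i) (b j)) (b k) * G (c i) (C (c k) (c j)) := by
    refine Finset.sum_congr rfl fun i _ => ?_
    rw [Finset.sum_comm]
    refine Finset.sum_congr rfl fun j _ => Finset.sum_congr rfl fun k _ => ?_
    rw [hskew (b i) (b k) (b j), ← neg_eq_iff_eq_neg.mpr (hskew (c k) (c i) (c j)),
      H.symm (b k), H.symm (C _ _) (c j)]
    ring
  rw [h1, h2, two_mul]
  -- With one of the two copies rewritten by `h3`, the identity holds term by term from cyclicity
  -- and skewness.
  nth_rw 2 [h3]
  simp only [← Finset.sum_add_distrib]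
  refine Finset.sum_congr rfl fun i _ => Finset.sum_congr rfl fun j _ =>
    Finset.sum_congr rfl fun k _ => ?_
  have hc := hcyc (c k) (c j) (c i)
  have hs := hskew (c j) (c i) (c k)
  rw [H.symm] at hs
  have : G (c k) (C (c i) (c j)) = G (c k) (C (c j) (c i)) + -G (c j) (C (c k) (c i)) := by
    linarith
  have hs2 := hskew (c k) (c i) (c j)
  rw [H.symm] at hs2
  rw [this, ← mul_add, hs2, neg_neg]

end IsDualPair

end DualPair

/-! ## (Para)contact metric structures to first order at a point -/

section Pointwise

variable {E : Type*} [NormedAddCommGroup E] [NormedSpace ℝ E]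

/-- The algebraic relations at a point between the metric `G`, the tensors `φ` and `ξ`, and their
covariant derivatives `A = ∇ξ` and `C = ∇φ`, for a (para)contact metric structure. -/
structure FirstOrderRelations (G : E →L[ℝ] E →L[ℝ] ℝ) (φ : E →L[ℝ] E) (ξ : E) (A : E →L[ℝ] E)
    (C : E →L[ℝ] E →L[ℝ] E) (ε₀ ε₁ : ℝ) : Prop where
  sq₀ : ε₀ * ε₀ = 1
  sq₁ : ε₁ * ε₁ = 1
  φ_sq : ∀ u, φ (φ u) = ε₁ • (u - (ε₀ * G ξ u) • ξ)
  φ_ξ : φ ξ = 0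
  φ_skew : ∀ u v, G (φ u) v = -G u (φ v)
  ξ_ξ : G ξ ξ = ε₀
  A_orth : ∀ u, G (A u) ξ = 0
  A_skew : ∀ u v, G (A u) v - G u (A v) = 2 * ε₀ * G u (φ v)
  C_skew : ∀ u v w, G (C u v) w = -G v (C u w)
  C_φ : ∀ u v, C u (φ v) + φ (C u v) = -(ε₁ * ε₀) • (G (A u) v • ξ + G ξ v • A u)
  C_ξ : ∀ u, C u ξ = -φ (A u)
  cyclic : ∀ u v w, G u (C w v) + G v (C u w) + G w (C v u) = 0

/-- The symmetric part `∇ξ + ε₀ φ` of `∇ξ`. -/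
def symmPart (φ A : E →L[ℝ] E) (ε₀ : ℝ) : E →L[ℝ] E := A + ε₀ • φ

theorem eq_symmPart_sub (φ A : E →L[ℝ] E) (ε₀ : ℝ) (u : E) :
    A u = symmPart φ A ε₀ u - ε₀ • φ u := by simp [symmPart]

namespace FirstOrderRelations

variable {G : E →L[ℝ] E →L[ℝ] ℝ} {φ : E →L[ℝ] E} {ξ : E} {A : E →L[ℝ] E}
  {C : E →L[ℝ] E →L[ℝ] E} {ε₀ ε₁ : ℝ} (F : FirstOrderRelations G φ ξ A C ε₀ ε₁)
  {ι : Type*} [Fintype ι] {b c : ι → E} (H : IsDualPair G b c)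

include F in
theorem symmPart_symm (u v : E) : G (symmPart φ A ε₀ u) v = G u (symmPart φ A ε₀ v) := by
  have h1 := F.A_skew u v
  have h2 := F.φ_skew u v
  simp [symmPart]; linear_combination h1 + ε₀ * h2

include F H

/-- The integral curves of `ξ` are geodesics: `ξ` has constant length and the skew part of `A`, a
multiple of `φ`, kills `ξ`. -/
theorem A_ξ : A ξ = 0 := by
  refine H.nondeg fun u => ?_
  have := F.A_skew u ξ
  rw [F.A_orth, F.φ_ξ, H.symm u] at this
  simpa using this

theorem symmPart_ξ : symmPart φ A ε₀ ξ = 0 := by simp [symmPart, F.A_ξ H, F.φ_ξ]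

theorem ξ_symmPart (u : E) : G ξ (symmPart φ A ε₀ u) = 0 := by
  rw [← F.symmPart_symm, F.symmPart_ξ H]; simp

/-- In the cyclic identity with `ξ` in one slot, the two terms other than `C ξ v` reduce to `A`
through `C_ξ` and `C_skew`. By `symmPart_φ` the right side is in fact zero. -/
theorem C_ξ_left (v : E) : C ξ v = -symmPart φ A ε₀ (φ v) - φ (symmPart φ A ε₀ v) := by
  refine H.ext fun u => ?_
  have h1 := F.cyclic u v ξ
  have h2 := F.C_skew v ξ u
  have h3 := F.A_skew (φ v) u
  have h4 := F.φ_skew v (A u)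
  have h7 := F.φ_skew (φ v) u
  rw [F.C_ξ] at h1 h2
  rw [H.symm u] at h1
  simp [symmPart] at *
  linear_combination h1 + h2 + h3 + h4 + 2 * ε₀ * h7

/-- Because `A ξ = 0`, the derivative of the equation for `φ²` along `ξ` says that `C ξ`
anticommutes with `φ`; now insert `C_ξ_left`. -/
theorem φ_symmPart_φ (v : E) :
    φ (symmPart φ A ε₀ (φ v)) = -ε₁ • symmPart φ A ε₀ v := by
  have h := F.C_φ ξ v
  rw [F.C_ξ_left H, F.C_ξ_left H, F.A_ξ H] at h
  simp only [F.φ_sq, F.symmPart_ξ H, F.ξ_symmPart H, map_sub, map_smul, map_neg, map_zero,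
    smul_zero, mul_zero, zero_smul, sub_zero, add_zero, _root_.zero_apply] at h
  have h2 : (2 : ℝ) • (φ (symmPart φ A ε₀ (φ v)) - -ε₁ • symmPart φ A ε₀ v) = 0 := by
    linear_combination (norm := module) -h
  exact sub_eq_zero.mp ((smul_eq_zero_iff_right two_ne_zero).mp h2)

/-- Apply `φ` to `φ_symmPart_φ`: the image of the symmetric part is orthogonal to `ξ`, and there
`φ²` is multiplication by `ε₁`. -/
theorem symmPart_φ (v : E) : symmPart φ A ε₀ (φ v) = -φ (symmPart φ A ε₀ v) := by
  have h := congrArg φ (F.φ_symmPart_φ H v)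
  rw [F.φ_sq, F.ξ_symmPart H, map_smul] at h
  have h2 := congrArg (fun x => ε₁ • x) h
  simp only [neg_smul, smul_neg, smul_smul, F.sq₁, mul_zero, zero_smul, sub_zero, one_smul] at h2
  exact h2

/-- `h = ½ L_ξ φ` in terms of the symmetric part of `∇ξ`. -/
theorem half_lieDer_eq (v : E) :
    (1 / 2 : ℝ) • (C ξ v - A (φ v) + φ (A v)) = φ (symmPart φ A ε₀ v) := by
  rw [F.C_ξ_left H, eq_symmPart_sub φ A ε₀ (φ v), eq_symmPart_sub φ A ε₀ v, F.symmPart_φ H]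
  simp only [map_sub, map_smul]
  module

theorem trace_φ : ∑ i, G (φ (b i)) (c i) = 0 := by
  have h1 : ∑ i, G (φ (b i)) (c i) = -∑ i, G (b i) (φ (c i)) := by
    rw [← Finset.sum_neg_distrib]; exact Finset.sum_congr rfl fun i _ => F.φ_skew _ _
  have h2 : ∑ i, G (b i) (φ (c i)) = ∑ i, G (c i) (φ (b i)) :=
    H.trace_swap (β := fun x y => G x (φ y))
      ⟨fun y => ⟨by simp, by simp⟩, fun y => ⟨by simp, by simp⟩⟩
  have h3 : ∑ i, G (c i) (φ (b i)) = ∑ i, G (φ (b i)) (c i) :=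
    Finset.sum_congr rfl fun i _ => H.symm _ _
  linarith

/-- For S the symmetric part, Tr φSφ is -ε₁ Tr S by `φ_symmPart_φ` and ε₁ Tr S by cyclicity, since
Sφ² = ε₁S. -/
theorem trace_symmPart : ∑ i, G (symmPart φ A ε₀ (b i)) (c i) = 0 := by
  have h1 := H.trace_comm φ (symmPart φ A ε₀ ∘L φ)
  have h2 : ∀ v, symmPart φ A ε₀ (φ (φ v)) = ε₁ • symmPart φ A ε₀ v := fun v => by
    rw [F.φ_sq]; simp [F.symmPart_ξ H]
  simp only [ContinuousLinearMap.comp_apply, F.φ_symmPart_φ H, h2, map_smul, smul_apply,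
    smul_eq_mul, ← Finset.mul_sum] at h1
  have h3 : ε₁ * (ε₁ * ∑ i, G (symmPart φ A ε₀ (b i)) (c i)) = 0 := by
    linear_combination (-ε₁ / 2) * h1
  rwa [← mul_assoc, F.sq₁, one_mul] at h3

theorem trace_A : ∑ i, G (A (b i)) (c i) = 0 := by
  simp only [eq_symmPart_sub φ A ε₀, map_sub, map_smul, sub_apply, smul_apply,
    Finset.sum_sub_distrib, F.trace_symmPart H, ← Finset.smul_sum, F.trace_φ H]
  simp

theorem trace_φ_sq : ∑ i, G (φ (φ (b i))) (c i) = ε₁ * (∑ i, G (b i) (c i) - 1) := by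
  have h1 : ∑ i, G ξ (b i) * G ξ (c i) = ε₀ := by
    simp only [H.symm ξ (c _), H.sum_mul, F.ξ_ξ]
  have h2 : ∀ i, G (φ (φ (b i))) (c i) = ε₁ * (G (b i) (c i) - ε₀ * (G ξ (b i) * G ξ (c i))) :=
    fun i => by
      rw [F.φ_sq]; simp only [map_smul, map_sub, sub_apply, smul_apply, smul_eq_mul]; ring
  rw [Finset.sum_congr rfl fun i _ => h2 i, ← Finset.mul_sum, Finset.sum_sub_distrib,
    ← Finset.mul_sum, h1, F.sq₀]

theorem trace_φ_symmPart : ∑ i, G (φ (symmPart φ A ε₀ (b i))) (c i) = 0 := by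
  have h := H.trace_comm φ (symmPart φ A ε₀)
  simp only [F.symmPart_φ H, map_neg, neg_apply, Finset.sum_neg_distrib] at h
  linarith

theorem trace_φ_A : ∑ i, G (φ (A (b i))) (c i) = -(ε₀ * ε₁) * (∑ i, G (b i) (c i) - 1) := by
  have h : ∀ i, G (φ (A (b i))) (c i) =
      G (φ (symmPart φ A ε₀ (b i))) (c i) - ε₀ * G (φ (φ (b i))) (c i) := fun i => by
    rw [eq_symmPart_sub φ A ε₀]; simp
  rw [Finset.sum_congr rfl fun i _ => h i, Finset.sum_sub_distrib, ← Finset.mul_sum,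
    F.trace_φ_symmPart H, F.trace_φ_sq H]
  ring

/-- `Tr (∇ξ)²` in terms of `h = φ (∇ξ + ε₀ φ)`. -/
theorem trace_A_sq : ∑ i, G (A (A (b i))) (c i) = ε₁ * (∑ i, G (b i) (c i) - 1) -
    ε₁ * ∑ i, G (φ (symmPart φ A ε₀ (φ (symmPart φ A ε₀ (b i))))) (c i) := by
  have h : ∀ v, A (A v) = φ (φ v) - ε₁ • φ (symmPart φ A ε₀ (φ (symmPart φ A ε₀ v))) := fun v => by
    rw [F.φ_symmPart_φ H, eq_symmPart_sub φ A ε₀ (A v), eq_symmPart_sub φ A ε₀ v]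
    simp only [map_sub, map_smul, F.symmPart_φ H, smul_smul]
    rw [mul_neg, F.sq₁]
    have := F.sq₀
    linear_combination (norm := module) this • φ (φ v)
  simp only [h, map_sub, map_smul, sub_apply, smul_apply, smul_eq_mul, Finset.sum_sub_distrib,
    ← Finset.mul_sum, F.trace_φ_sq H]

/-- `|h|² = Tr h²`. -/
theorem normSq_eq : ∑ i, G (φ (symmPart φ A ε₀ (b i))) (φ (symmPart φ A ε₀ (c i))) =
    ∑ i, G (φ (symmPart φ A ε₀ (φ (symmPart φ A ε₀ (b i))))) (c i) := by
  -- The endomorphism φS is self-adjoint: S is symmetric, `φ` is skew, and the two anticommute.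
  refine Finset.sum_congr rfl fun i _ => ?_
  rw [F.φ_skew (symmPart _ _ _ (φ _)), F.symmPart_symm, F.symmPart_φ H, map_neg, neg_neg]

/-- Tracing `C_φ` gives twice this sum on the left and a multiple of `G (A z) ξ = 0` on the right.
-/
theorem trace_C_φ (z : E) : ∑ i, G (c i) (φ (C z (b i))) = 0 := by
  have h1 := H.trace_comm φ (C z)
  have h2 : ∀ i, G (C z (φ (b i))) (c i) = -G (φ (C z (b i))) (c i) -
      ε₁ * ε₀ * (G (A z) (b i) * G (c i) ξ + G ξ (b i) * G (c i) (A z)) := fun i => by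
    have h := congrArg (fun x => G x (c i)) (F.C_φ z (b i))
    simp only [map_add, map_smul, add_apply, smul_apply, smul_eq_mul,
      H.symm ξ (c i), H.symm (A z) (c i)] at h
    linear_combination h
  simp only [h2, Finset.sum_sub_distrib, ← Finset.mul_sum, Finset.sum_add_distrib, H.sum_mul,
    H.symm ξ (A z), F.A_orth, Finset.sum_neg_distrib] at h1
  simp only [H.symm (c _)]
  linarith

/-- Let X be the sum. In the cyclic identity on `z`, `φ (c i)`, `b i`, one term sums to zero by
`trace_C_φ`, and the other two each contribute G(X, z), since moving the skew `φ` across the trace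
turns the sum of `C (φ (c i)) (b i)` into -X. -/
theorem sum_C_φ : ∑ i, C (b i) (φ (c i)) = 0 := by
  refine H.nondeg fun z => ?_
  have hC : IsBilin fun x y => C x y := ⟨fun y => ⟨by simp, by simp⟩, fun y => ⟨by simp, by simp⟩⟩
  have hCφ : IsBilin fun x y => C x (φ y) :=
    ⟨fun y => ⟨by simp, by simp⟩, fun y => ⟨by simp, by simp⟩⟩
  have h1 : ∑ i, C (φ (c i)) (b i) = -∑ i, C (b i) (φ (c i)) := by
    rw [H.swap.trace_adjoint hC (T := φ) (T' := fun x => -φ x) (by simp [F.φ_skew]),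
      H.trace_swap hCφ]
    simp
  have h2 : ∀ i, G (C (b i) (φ (c i))) z - G (c i) (φ (C z (b i))) - G (C (φ (c i)) (b i)) z = 0 :=
    fun i => by
      have h3 := F.cyclic z (φ (c i)) (b i)
      have h4 := F.φ_skew (c i) (C z (b i))
      have h5 := F.C_skew (φ (c i)) (b i) z
      rw [H.symm z] at h3
      linear_combination h3 - h4 - h5
  have h3 := Finset.sum_congr (rfl : (Finset.univ : Finset ι) = _) fun i _ => h2 i
  rw [Finset.sum_sub_distrib, Finset.sum_sub_distrib, F.trace_C_φ H, Finset.sum_const_zero] at h3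
  have h4 := congrArg (fun x => G x z) h1
  simp only [map_sum, map_neg, sum_apply, neg_apply] at h4 ⊢
  linarith

/-- Tracing `C_φ` shows that `φ` kills the sum, which is therefore a multiple of `ξ`; pairing with
`ξ` finds the multiple as the trace of `φ A`. -/
theorem sum_C : ∑ i, C (b i) (c i) = -(ε₁ * (∑ i, G (b i) (c i) - 1)) • ξ := by
  have h1 : φ (∑ i, C (b i) (c i)) = 0 := by
    have h : ∀ i, φ (C (b i) (c i)) = -C (b i) (φ (c i)) -
        (ε₁ * ε₀) • (G (A (b i)) (c i) • ξ + G ξ (c i) • A (b i)) := fun i => by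
      linear_combination (norm := module) F.C_φ (b i) (c i)
    rw [map_sum, Finset.sum_congr rfl fun i _ => h i, Finset.sum_sub_distrib,
      Finset.sum_neg_distrib, F.sum_C_φ H, ← Finset.smul_sum, Finset.sum_add_distrib,
      ← Finset.sum_smul, F.trace_A H, H.sum_apply_left ⟨by simp, by simp⟩, F.A_ξ H]
    simp
  have h2 : G ξ (∑ i, C (b i) (c i)) = -(ε₀ * ε₁) * (∑ i, G (b i) (c i) - 1) := by
    rw [map_sum, ← F.trace_φ_A H]
    refine Finset.sum_congr rfl fun i _ => ?_
    rw [H.symm, F.C_skew, F.C_ξ, map_neg, neg_neg, H.symm]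
  have h3 := F.φ_sq (∑ i, C (b i) (c i))
  rw [h1, map_zero, h2] at h3
  have h4 := congrArg (fun x => ε₁ • x) h3
  simp only [smul_smul, F.sq₁, smul_zero, one_smul] at h4
  have h5 : ε₀ * (-(ε₀ * ε₁) * (∑ i, G (b i) (c i) - 1)) =
      -(ε₁ * (∑ i, G (b i) (c i) - 1)) := by
    linear_combination (-(ε₁ * (∑ i, G (b i) (c i) - 1))) * F.sq₀
  rw [h5] at h4
  exact (sub_eq_zero.mp h4.symm)

end FirstOrderRelations

end Pointwise

/-! ### Traces of the Ricci identities at a point. -/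

section PointwiseCurvature

variable {E : Type*} [NormedAddCommGroup E] [NormedSpace ℝ E]

/-- The relations at a point between the curvature operator `R`, the second covariant derivative
`N w u v = (∇²_{w,u} φ) v` and the tensors `G`, `φ`, `ξ`, `A = ∇ξ`, `C = ∇φ`. Here `b`, `c` is a dual
pair of bases and `m` is one less than the dimension. -/
structure SecondOrderRelations (G : E →L[ℝ] E →L[ℝ] ℝ) (φ : E →L[ℝ] E) (ξ : E) (A : E →L[ℝ] E)
    (C : E →L[ℝ] E →L[ℝ] E) {ι : Type*} [Fintype ι] (b c : ι → E) (ε₁ m : ℝ)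
    (R N : E → E → E → E) : Prop where
  R_lin : ∀ v w, IsLinearMap ℝ fun u => R u v w
  R_swap : ∀ u v w, R u v w = -R v u w
  R_skew : ∀ u v w z, G (R u v w) z = -G w (R u v z)
  ricci_ξ : ∑ i, G (c i) (R (b i) ξ ξ) = -∑ i, G (A (A (b i))) (c i)
  ricci_φ : ∀ u v w, R u v (φ w) = φ (R u v w) + N u v w - N v u w
  N_skew : ∀ w u v z, G (N w u v) z = -G v (N w u z)
  sum_N : ∀ w, ∑ i, N w (b i) (c i) = -(ε₁ * m) • A w
  sum_N_φ : ∀ w, ∑ i, N w (b i) (φ (c i)) = -∑ i, C (b i) (C w (c i))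

namespace SecondOrderRelations

variable {G : E →L[ℝ] E →L[ℝ] ℝ} {φ : E →L[ℝ] E} {ξ : E} {A : E →L[ℝ] E}
  {C : E →L[ℝ] E →L[ℝ] E} {ε₀ ε₁ m : ℝ} {ι : Type*} [Fintype ι] {b c : ι → E}
  {R N : E → E → E → E}
  (K : SecondOrderRelations G φ ξ A C b c ε₁ m R N)
  (F : FirstOrderRelations G φ ξ A C ε₀ ε₁) (H : IsDualPair G b c)
  (hm : ∑ i, G (b i) (c i) = m + 1)
include K F H hm

theorem ricci_ξ_eq : ∑ i, G (c i) (R (b i) ξ ξ) = -ε₁ *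
    (m - ∑ i, G (φ (symmPart φ A ε₀ (b i))) (φ (symmPart φ A ε₀ (c i)))) := by
  rw [K.ricci_ξ, F.trace_A_sq H, F.normSq_eq H, hm]; ring

theorem scalar_add : ∑ j, ∑ i, G (R (b j) (b i) (φ (c i))) (φ (c j)) +
      ε₁ * ∑ i, ∑ j, G (c j) (R (b j) (b i) (c i)) =
    ε₀ * ε₁ * ∑ i, G (c i) (R (b i) ξ ξ) - ε₀ * m ^ 2 +
      1 / 2 * ∑ i, ∑ j, G (C (b i) (b j)) (C (c i) (c j)) := by
  have hφφ : ∀ x y, G (φ x) (φ y) = -ε₁ * G x y + ε₀ * ε₁ * (G ξ y * G x ξ) := fun x y => by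
    rw [F.φ_skew, F.φ_sq]; simp only [map_smul, map_sub, smul_eq_mul]; ring
  -- After the Ricci identity for `φ`, compatibility of `φ` with `G` cancels the `ε₁` curvature term
  -- up to its `ξ` component; the two terms in `N` remain.
  have h0 : ∀ i j, G (R (b j) (b i) (φ (c i))) (φ (c j)) + ε₁ * G (c j) (R (b j) (b i) (c i)) =
      ε₀ * ε₁ * (G ξ (c j) * G (R (b j) (b i) (c i)) ξ) + G (N (b j) (b i) (c i)) (φ (c j)) +
        G (c i) (N (b i) (b j) (φ (c j))) := fun i j => by
    rw [K.ricci_φ, map_sub, map_add, sub_apply, add_apply, hφφ, K.N_skew (b i),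
      H.symm (c j) (R _ _ _)]
    ring
  have h1 : ∑ i, ∑ j, G ξ (c j) * G (R (b j) (b i) (c i)) ξ = ∑ i, G (c i) (R (b i) ξ ξ) := by
    refine Finset.sum_congr rfl fun i _ => ?_
    have hl : IsLinearMap ℝ fun x => G (R x (b i) (c i)) ξ :=
      ⟨fun x y => by simp [(K.R_lin _ _).map_add], fun a x => by simp [(K.R_lin _ _).map_smul]⟩
    have := H.sum_apply_left hl ξ
    simp only [smul_eq_mul] at this
    rw [this, K.R_skew, K.R_swap]
    simp
  -- One factor `m` comes from the divergence of `φ` in `sum_N`, the other from the trace of `φ A`.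
  have h2 : ∑ i, ∑ j, G (N (b j) (b i) (c i)) (φ (c j)) = -(ε₀ * m ^ 2) := by
    rw [Finset.sum_comm]
    have h : ∀ j, ∑ i, G (N (b j) (b i) (c i)) (φ (c j)) = ε₁ * m * G (φ (A (b j))) (c j) :=
      fun j => by
        rw [← sum_apply, ← map_sum, K.sum_N, map_smul, smul_apply, smul_eq_mul, F.φ_skew]; ring
    rw [Finset.sum_congr rfl fun j _ => h j, ← Finset.mul_sum, F.trace_φ_A H, hm]
    linear_combination (-ε₀ * m ^ 2) * F.sq₁
  have h3 : ∑ i, ∑ j, G (c i) (N (b i) (b j) (φ (c j))) =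
      ∑ i, ∑ j, G (C (b i) (b j)) (C (c j) (c i)) := by
    have h : ∀ i, ∑ j, G (c i) (N (b i) (b j) (φ (c j))) =
        ∑ j, G (C (b j) (c i)) (C (b i) (c j)) := fun i => by
      rw [← map_sum, K.sum_N_φ, map_neg, map_sum, ← Finset.sum_neg_distrib]
      exact Finset.sum_congr rfl fun j _ => by rw [F.C_skew]
    rw [Finset.sum_congr rfl fun i _ => h i, Finset.sum_comm]
    refine Finset.sum_congr rfl fun j _ => ?_
    exact H.swap.trace_swap (β := fun x y => G (C (b j) x) (C y (c j)))
      ⟨fun y => ⟨by simp, by simp⟩, fun y => ⟨by simp, by simp⟩⟩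
  rw [H.contraction_of_cyclic F.C_skew F.cyclic, ← h3, Finset.sum_comm, Finset.mul_sum]
  simp only [Finset.mul_sum]
  simp only [← Finset.sum_add_distrib, h0]
  simp only [Finset.sum_add_distrib, ← Finset.mul_sum, h1, h2]
  ring

end SecondOrderRelations

end PointwiseCurvature

/-! ### Covariant derivatives on a vector space and the Ricci identities. -/

section Calculus

set_option maxSynthPendingDepth 3

variable {E : Type*} [NormedAddCommGroup E] [NormedSpace ℝ E]
  {F : Type*} [NormedAddCommGroup F] [NormedSpace ℝ F]

theorem fderiv_clm_apply_const {f : E → (E →L[ℝ] F)} {p : E} (hf : DifferentiableAt ℝ f p)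
    (x w : E) : fderiv ℝ (fun q => f q x) p w = fderiv ℝ f p w x := by
  rw [fderiv_clm_apply hf (differentiableAt_const x)]; simp

/-- Exchange of the two arguments of a bilinear form, as a continuous linear map. -/
noncomputable def flipCLM (E : Type*) [NormedAddCommGroup E] [NormedSpace ℝ E] :
    (E →L[ℝ] E →L[ℝ] ℝ) →L[ℝ] (E →L[ℝ] E →L[ℝ] ℝ) :=
  (ContinuousLinearMap.flipₗᵢ ℝ E E ℝ).toContinuousLinearEquiv.toContinuousLinearMap

/-- Exchange of the first two arguments of a trilinear form, as a continuous linear map. -/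
noncomputable def flipCLM₃ (E : Type*) [NormedAddCommGroup E] [NormedSpace ℝ E] :
    (E →L[ℝ] E →L[ℝ] E →L[ℝ] ℝ) →L[ℝ] (E →L[ℝ] E →L[ℝ] E →L[ℝ] ℝ) :=
  (ContinuousLinearMap.flipₗᵢ ℝ E E (E →L[ℝ] ℝ)).toContinuousLinearEquiv.toContinuousLinearMap

/-- The Christoffel symbols of the first kind as a trilinear map. -/
noncomputable def christoffelFirstL (g : E → (E →L[ℝ] E →L[ℝ] ℝ)) (p : E) :
    E →L[ℝ] E →L[ℝ] E →L[ℝ] ℝ :=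
  (1 / 2 : ℝ) • (fderiv ℝ g p + flipCLM₃ E (fderiv ℝ g p) -
    (flipCLM E).comp (flipCLM₃ E (fderiv ℝ g p)))

/-- The Christoffel symbols as a bilinear map. -/
noncomputable def christoffelL (g : E → (E →L[ℝ] E →L[ℝ] ℝ)) (p : E) : E →L[ℝ] E →L[ℝ] E :=
  (ContinuousLinearMap.compL ℝ E (E →L[ℝ] ℝ) E (g p).inverse) ∘L christoffelFirstL g p

theorem christoffelL_apply (g : E → (E →L[ℝ] E →L[ℝ] ℝ)) (p u v : E) :
    christoffelL g p u v = christoffel g p u v := rfl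

/-- The covariant derivative `∇_w X` of a vector field, for a connection with symbols `Γ`. -/
noncomputable def cov (Γ : E → (E →L[ℝ] E →L[ℝ] E)) (X : E → E) (p w : E) : E :=
  fderiv ℝ X p w + Γ p w (X p)

/-- The covariant derivative `∇φ` of a `(1,1)`-tensor field, as a bilinear map. -/
noncomputable def covEnd (Γ : E → (E →L[ℝ] E →L[ℝ] E)) (φ : E → (E →L[ℝ] E)) (p : E) :
    E →L[ℝ] E →L[ℝ] E :=
  fderiv ℝ φ p + (ContinuousLinearMap.compL ℝ E E E).flip (φ p) ∘L Γ p -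
    ContinuousLinearMap.compL ℝ E E E (φ p) ∘L Γ p

/-- The covariant derivative `∇ξ` of a vector field, as an endomorphism. -/
noncomputable def covVec (Γ : E → (E →L[ℝ] E →L[ℝ] E)) (ξ : E → E) (p : E) : E →L[ℝ] E :=
  fderiv ℝ ξ p + (Γ p).flip (ξ p)

/-- The covariant derivative `(∇_w β)(u, v)` of a `(1,2)`-tensor field. -/
noncomputable def covBilin (Γ : E → (E →L[ℝ] E →L[ℝ] E)) (β : E → (E →L[ℝ] E →L[ℝ] E))
    (p w u v : E) : E :=
  fderiv ℝ β p w u v + Γ p w (β p u v) - β p (Γ p w u) v - β p u (Γ p w v)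

variable {Γ : E → (E →L[ℝ] E →L[ℝ] E)} {p : E}

theorem covEnd_apply (φ : E → (E →L[ℝ] E)) (p u v : E) :
    covEnd Γ φ p u v = fderiv ℝ φ p u v + Γ p u (φ p v) - φ p (Γ p u v) := rfl

theorem covVec_apply (ξ : E → E) (p u : E) : covVec Γ ξ p u = cov Γ ξ p u := rfl

theorem cov_const (x w : E) : cov Γ (fun _ => x) p w = Γ p w x := by simp [cov]

theorem cov_congr {X Y : E → E} (h : X =ᶠ[nhds p] Y) (w : E) : cov Γ X p w = cov Γ Y p w := by
  rw [cov, cov, h.fderiv_eq, h.eq_of_nhds]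

theorem cov_end_apply {φ : E → (E →L[ℝ] E)} {X : E → E} (hφ : DifferentiableAt ℝ φ p)
    (hX : DifferentiableAt ℝ X p) (w : E) :
    cov Γ (fun q => φ q (X q)) p w = covEnd Γ φ p w (X p) + φ p (cov Γ X p w) := by
  rw [cov, fderiv_clm_apply hφ hX, covEnd_apply, cov]
  simp
  abel

theorem cov_bilin_apply {β : E → (E →L[ℝ] E →L[ℝ] E)} (hβ : DifferentiableAt ℝ β p) (w u v : E) :
    cov Γ (fun q => β q u v) p w =
      covBilin Γ β p w u v + β p (Γ p w u) v + β p u (Γ p w v) := by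
  have h : DifferentiableAt ℝ (fun q => β q u) p := hβ.clm_apply (differentiableAt_const _)
  rw [cov, covBilin, fderiv_clm_apply_const h, fderiv_clm_apply_const hβ]
  abel

theorem cov_smul_field {a : E → ℝ} {X : E → E} (ha : DifferentiableAt ℝ a p)
    (hX : DifferentiableAt ℝ X p) (w : E) :
    cov Γ (fun q => a q • X q) p w = fderiv ℝ a p w • X p + a p • cov Γ X p w := by
  rw [cov, fderiv_fun_smul ha hX, cov]
  simp
  abel

theorem cov_const_smul (a : ℝ) {X : E → E} (hX : DifferentiableAt ℝ X p) (w : E) :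
    cov Γ (fun q => a • X q) p w = a • cov Γ X p w := by
  rw [cov_smul_field (differentiableAt_const a) hX]; simp

theorem cov_sub {X Y : E → E} (hX : DifferentiableAt ℝ X p) (hY : DifferentiableAt ℝ Y p)
    (w : E) : cov Γ (fun q => X q - Y q) p w = cov Γ X p w - cov Γ Y p w := by
  rw [cov, fderiv_fun_sub hX hY, cov, cov]
  simp
  abel

theorem contDiffAt_covEnd {φ : E → (E →L[ℝ] E)} (hφ : ContDiffAt ℝ ∞ φ p)
    (hΓ : ContDiffAt ℝ ∞ Γ p) : ContDiffAt ℝ ∞ (covEnd Γ φ) p :=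
  ((hφ.fderiv_right (m := ∞) (by simp)).add (ContDiffAt.clm_comp
    ((ContinuousLinearMap.compL ℝ E E E).flip.contDiff.contDiffAt.comp p hφ) hΓ)).sub
    (ContDiffAt.clm_comp ((ContinuousLinearMap.compL ℝ E E E).contDiff.contDiffAt.comp p hφ) hΓ)

theorem contDiffAt_covVec {ξ : E → E} (hξ : ContDiffAt ℝ ∞ ξ p)
    (hΓ : ContDiffAt ℝ ∞ Γ p) : ContDiffAt ℝ ∞ (covVec Γ ξ) p :=
  (hξ.fderiv_right (m := ∞) (by simp)).add (ContDiffAt.clm_apply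
    ((ContinuousLinearMap.flipₗᵢ ℝ E E E).toContinuousLinearEquiv.contDiff.contDiffAt.comp p hΓ) hξ)

/-- Ricci identity for a `(1,1)`-tensor field. -/
theorem ricci_identity_end {φ : E → (E →L[ℝ] E)} (hφ : ContDiffAt ℝ ∞ φ p)
    (hΓ : ContDiffAt ℝ ∞ Γ p) (hsymm : ∀ u v, Γ p u v = Γ p v u) (u v w : E) :
    cov Γ (fun q => Γ q v (φ p w)) p u - cov Γ (fun q => Γ q u (φ p w)) p v =
      φ p (cov Γ (fun q => Γ q v w) p u - cov Γ (fun q => Γ q u w) p v) +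
        covBilin Γ (covEnd Γ φ) p u v w - covBilin Γ (covEnd Γ φ) p v u w := by
  have hφ1 : DifferentiableAt ℝ φ p := hφ.differentiableAt (by simp)
  have hφ2 : DifferentiableAt ℝ (fderiv ℝ φ) p :=
    (hφ.fderiv_right (m := ∞) (by simp)).differentiableAt (by simp)
  have hΓ1 : DifferentiableAt ℝ Γ p := hΓ.differentiableAt (by simp)
  have hs : fderiv ℝ (fderiv ℝ φ) p u v = fderiv ℝ (fderiv ℝ φ) p v u :=
    hφ.isSymmSndFDerivAt (by simp [ENat.LEInfty.out]) u v
  have hC : DifferentiableAt ℝ (covEnd Γ φ) p :=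
    (contDiffAt_covEnd hφ hΓ).differentiableAt (by simp)
  have d1 : ∀ b : E, DifferentiableAt ℝ (fun q => fderiv ℝ φ q b) p := fun b =>
    hφ2.clm_apply (differentiableAt_const b)
  have d2 : ∀ b : E, DifferentiableAt ℝ (fun q => Γ q b) p := fun b =>
    hΓ1.clm_apply (differentiableAt_const b)
  have d3 : ∀ b x : E, DifferentiableAt ℝ (fun q => Γ q b x) p := fun b x =>
    (d2 b).clm_apply (differentiableAt_const x)
  have d4 : ∀ x : E, DifferentiableAt ℝ (fun q => φ q x) p := fun x =>
    hφ1.clm_apply (differentiableAt_const x)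
  have g3 : ∀ a b x : E, fderiv ℝ (fun q => Γ q b x) p a = fderiv ℝ Γ p a b x := fun a b x => by
    rw [fderiv_clm_apply_const (d2 b), fderiv_clm_apply_const hΓ1]
  have e : ∀ a b : E, fderiv ℝ (covEnd Γ φ) p a b w =
      fderiv ℝ (fderiv ℝ φ) p a b w + (fderiv ℝ Γ p a b (φ p w) + Γ p b (fderiv ℝ φ p a w)) -
        (fderiv ℝ φ p a (Γ p b w) + φ p (fderiv ℝ Γ p a b w)) := fun a b => by
    rw [← fderiv_clm_apply_const hC,
      ← fderiv_clm_apply_const (hC.clm_apply (differentiableAt_const b))]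
    have h1 : (fun q => covEnd Γ φ q b w) =
        fun q => fderiv ℝ φ q b w + Γ q b (φ q w) - φ q (Γ q b w) := rfl
    rw [h1, fderiv_fun_sub (((d1 b).clm_apply (differentiableAt_const w)).fun_add
      ((d2 b).clm_apply (d4 w))) (hφ1.clm_apply (d3 b w)),
      fderiv_fun_add ((d1 b).clm_apply (differentiableAt_const w)) ((d2 b).clm_apply (d4 w)),
      fderiv_clm_apply (d2 b) (d4 w), fderiv_clm_apply hφ1 (d3 b w)]
    simp only [add_apply, sub_apply, ContinuousLinearMap.comp_apply,
      ContinuousLinearMap.flip_apply]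
    rw [fderiv_clm_apply_const (d1 b), fderiv_clm_apply_const hφ2, fderiv_clm_apply_const hΓ1, g3,
      fderiv_clm_apply_const hφ1]
    abel
  simp only [cov, covBilin, e, covEnd_apply, g3, map_add, map_sub]
  -- Antisymmetrization removes the second derivatives of `φ`, and absence of torsion removes the
  -- terms containing `Γ p u v`.
  rw [hs, hsymm u v]
  abel

/-- Ricci identity for a vector field. -/
theorem ricci_identity_vec {ξ : E → E} (hξ : ContDiffAt ℝ ∞ ξ p)
    (hΓ : ContDiffAt ℝ ∞ Γ p) (hsymm : ∀ u v, Γ p u v = Γ p v u) (u v : E) :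
    cov Γ (fun q => Γ q v (ξ p)) p u - cov Γ (fun q => Γ q u (ξ p)) p v =
      covEnd Γ (covVec Γ ξ) p u v - covEnd Γ (covVec Γ ξ) p v u := by
  have hξ1 : DifferentiableAt ℝ ξ p := hξ.differentiableAt (by simp)
  have hξ2 : DifferentiableAt ℝ (fderiv ℝ ξ) p :=
    (hξ.fderiv_right (m := ∞) (by simp)).differentiableAt (by simp)
  have hΓ1 : DifferentiableAt ℝ Γ p := hΓ.differentiableAt (by simp)
  have hs : fderiv ℝ (fderiv ℝ ξ) p u v = fderiv ℝ (fderiv ℝ ξ) p v u :=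
    hξ.isSymmSndFDerivAt (by simp [ENat.LEInfty.out]) u v
  have hA : DifferentiableAt ℝ (covVec Γ ξ) p :=
    (contDiffAt_covVec hξ hΓ).differentiableAt (by simp)
  have d2 : ∀ b : E, DifferentiableAt ℝ (fun q => Γ q b) p := fun b =>
    hΓ1.clm_apply (differentiableAt_const b)
  have g3 : ∀ a b x : E, fderiv ℝ (fun q => Γ q b x) p a = fderiv ℝ Γ p a b x := fun a b x => by
    rw [fderiv_clm_apply_const (d2 b), fderiv_clm_apply_const hΓ1]
  have e : ∀ a b : E, fderiv ℝ (covVec Γ ξ) p a b =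
      fderiv ℝ (fderiv ℝ ξ) p a b + (fderiv ℝ Γ p a b (ξ p) + Γ p b (fderiv ℝ ξ p a)) :=
    fun a b => by
    rw [← fderiv_clm_apply_const hA]
    have h1 : (fun q => covVec Γ ξ q b) = fun q => fderiv ℝ ξ q b + Γ q b (ξ q) := rfl
    rw [h1, fderiv_fun_add (hξ2.clm_apply (differentiableAt_const b)) ((d2 b).clm_apply hξ1),
      fderiv_clm_apply (d2 b) hξ1, add_apply, fderiv_clm_apply_const hξ2]
    simp only [add_apply, ContinuousLinearMap.comp_apply, ContinuousLinearMap.flip_apply]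
    rw [fderiv_clm_apply_const hΓ1]
    abel
  simp only [cov, covEnd_apply, e, covVec_apply, g3, map_add]
  rw [hs, hsymm u v]
  abel

end Calculus

/-! ### The Levi-Civita connection of a metric on an open set. -/

section LeviCivita

set_option maxSynthPendingDepth 3

variable {E : Type*} [NormedAddCommGroup E] [NormedSpace ℝ E]

/-- The curvature operator of a connection with symbols `Γ`. -/
noncomputable def curv (Γ : E → (E →L[ℝ] E →L[ℝ] E)) (p u v w : E) : E :=
  cov Γ (fun q => Γ q v w) p u - cov Γ (fun q => Γ q u w) p v

/-- Constant fields commute, and the covariant derivative of the constant field `w` along `v` is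
Γ(v, w). This form of the curvature is the one in the Ricci identities. -/
theorem riemann_eq_curv (g : E → (E →L[ℝ] E →L[ℝ] ℝ)) (p u v w : E) :
    riemann g p u v w = curv (christoffelL g) p u v w := by
  simp only [riemann, curv, cov, christoffelL_apply]
  abel

/-- A smooth pseudo-Riemannian metric on an open subset of a vector space. -/
structure IsMetricOn (U : Set E) (g : E → (E →L[ℝ] E →L[ℝ] ℝ)) : Prop where
  isOpen : IsOpen U
  smooth : ∀ p ∈ U, ContDiffAt ℝ ∞ g p
  symm : ∀ p ∈ U, ∀ u v, g p u v = g p v u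
  nondeg : ∀ p ∈ U, ∀ u, (∀ v, g p u v = 0) → u = 0

/-- A nondegenerate bilinear form on a finite-dimensional space is invertible. -/
theorem isInvertible_of_nondeg [FiniteDimensional ℝ E] {G : E →L[ℝ] E →L[ℝ] ℝ}
    (h : ∀ u, (∀ v, G u v = 0) → u = 0) : G.IsInvertible := by
  have hinj : Function.Injective (G : E →ₗ[ℝ] E →L[ℝ] ℝ) := by
    rw [← LinearMap.ker_eq_bot, LinearMap.ker_eq_bot']
    exact fun u hu => h u fun v => by
      have := congrArg (fun f : E →L[ℝ] ℝ => f v) hu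
      simpa using this
  have hdim : Module.finrank ℝ E = Module.finrank ℝ (E →L[ℝ] ℝ) := by
    rw [← LinearEquiv.finrank_eq (LinearMap.toContinuousLinearMap (𝕜 := ℝ) (E := E) (F' := ℝ))]
    exact (Subspace.dual_finrank_eq).symm
  exact ⟨(LinearEquiv.ofInjectiveOfFinrankEq _ hinj hdim).toContinuousLinearEquiv, by ext; rfl⟩

/-- This is the very pair of families used by `metricTrace`, so the trace lemmas apply without a
change of basis. -/
theorem isDualPair_finBasis [FiniteDimensional ℝ E] {G : E →L[ℝ] E →L[ℝ] ℝ}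
    (hs : ∀ u v, G u v = G v u) (h : ∀ u, (∀ v, G u v = 0) → u = 0) :
    IsDualPair G (Module.finBasis ℝ E) fun i =>
      G.inverse (LinearMap.toContinuousLinearMap ((Module.finBasis ℝ E).coord i)) := by
  have hc : ∀ i v, G v (G.inverse (LinearMap.toContinuousLinearMap
      ((Module.finBasis ℝ E).coord i))) = (Module.finBasis ℝ E).coord i v := fun i v => by
    rw [hs, (isInvertible_of_nondeg h).self_apply_inverse]; rfl
  have hl : ∀ v, ∑ i, G v (G.inverse (LinearMap.toContinuousLinearMap
      ((Module.finBasis ℝ E).coord i))) • Module.finBasis ℝ E i = v := fun v => by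
    simp only [hc]
    exact (Module.finBasis ℝ E).sum_repr v
  refine ⟨hs, hl, fun v => ?_⟩
  rw [← sub_eq_zero]
  refine h _ fun w => ?_
  have h1 := congrArg (G v) (hl w)
  simp only [map_sum, map_smul, smul_eq_mul] at h1
  simp only [map_sub, sub_apply, map_sum, map_smul, sum_apply, smul_apply, smul_eq_mul,
    hs _ w, sub_eq_zero]
  rw [hs w v, ← h1]
  exact Finset.sum_congr rfl fun i _ => mul_comm _ _

theorem sum_finBasis [FiniteDimensional ℝ E] {G : E →L[ℝ] E →L[ℝ] ℝ}
    (hs : ∀ u v, G u v = G v u) (h : ∀ u, (∀ v, G u v = 0) → u = 0) :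
    ∑ i, G (Module.finBasis ℝ E i) (G.inverse (LinearMap.toContinuousLinearMap
      ((Module.finBasis ℝ E).coord i))) = Module.finrank ℝ E := by
  have hc : ∀ i, G (Module.finBasis ℝ E i) (G.inverse (LinearMap.toContinuousLinearMap
      ((Module.finBasis ℝ E).coord i))) = 1 := fun i => by
    rw [hs, (isInvertible_of_nondeg h).self_apply_inverse]; simp
  simp [hc]

namespace IsMetricOn

variable {U : Set E} {g : E → (E →L[ℝ] E →L[ℝ] ℝ)} (hg : IsMetricOn U g)
include hg

theorem eventually {p : E} (hp : p ∈ U) : ∀ᶠ q in nhds p, q ∈ U := hg.isOpen.mem_nhds hp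

theorem fderiv_symm {p : E} (hp : p ∈ U) (w u v : E) :
    fderiv ℝ g p w u v = fderiv ℝ g p w v u := by
  have h1 : DifferentiableAt ℝ g p := (hg.smooth p hp).differentiableAt (by simp)
  have e : ∀ a b : E, fderiv ℝ (fun q => g q a b) p w = fderiv ℝ g p w a b := fun a b => by
    rw [fderiv_clm_apply_const (h1.clm_apply (differentiableAt_const a)),
      fderiv_clm_apply_const h1]
  have h2 : (fun q => g q u v) =ᶠ[nhds p] fun q => g q v u :=
    (hg.eventually hp).mono fun q hq => hg.symm q hq u v
  rw [← e, ← e, h2.fderiv_eq]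

variable [FiniteDimensional ℝ E]

theorem apply_christoffel {p : E} (hp : p ∈ U) (u v w : E) :
    g p (christoffelL g p u v) w =
      (1 / 2 : ℝ) * (fderiv ℝ g p u v w + fderiv ℝ g p v u w - fderiv ℝ g p w u v) := by
  rw [christoffelL_apply, christoffel,
    (isInvertible_of_nondeg (hg.nondeg p hp)).self_apply_inverse, christoffelFirst_apply]

theorem christoffel_symm {p : E} (hp : p ∈ U) (u v : E) :
    christoffelL g p u v = christoffelL g p v u := by
  rw [← sub_eq_zero]
  refine hg.nondeg p hp _ fun w => ?_
  rw [map_sub, sub_apply, hg.apply_christoffel hp, hg.apply_christoffel hp,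
    hg.fderiv_symm hp w u v]
  ring

theorem compat {p : E} (hp : p ∈ U) (w u v : E) :
    fderiv ℝ g p w u v = g p (christoffelL g p w u) v + g p u (christoffelL g p w v) := by
  rw [hg.symm p hp u, hg.apply_christoffel hp, hg.apply_christoffel hp, hg.fderiv_symm hp w v u]
  ring

theorem smooth_christoffel {p : E} (hp : p ∈ U) : ContDiffAt ℝ ∞ (christoffelL g) p := by
  have : CompleteSpace E := FiniteDimensional.complete ℝ E
  have hD : ContDiffAt ℝ ∞ (fderiv ℝ g) p := (hg.smooth p hp).fderiv_right (m := ∞) (by simp)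
  have hD' : ContDiffAt ℝ ∞ (fun q => flipCLM₃ E (fderiv ℝ g q)) p :=
    (flipCLM₃ E).contDiff.contDiffAt.comp p hD
  have hF : ContDiffAt ℝ ∞ (christoffelFirstL g) p :=
    ((hD.add hD').sub (contDiffAt_const (c := flipCLM E) |>.clm_comp hD')).const_smul (1 / 2 : ℝ)
  have hI : ContDiffAt ℝ ∞ (fun q => (g q).inverse) p :=
    ((isInvertible_of_nondeg (hg.nondeg p hp)).contDiffAt_map_inverse).comp p (hg.smooth p hp)
  exact ContDiffAt.clm_comp
    ((ContinuousLinearMap.compL ℝ E (E →L[ℝ] ℝ) E).contDiff.contDiffAt.comp p hI) hF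

theorem fderiv_apply {p : E} (hp : p ∈ U) {X Y : E → E} (hX : DifferentiableAt ℝ X p)
    (hY : DifferentiableAt ℝ Y p) (w : E) :
    fderiv ℝ (fun q => g q (X q) (Y q)) p w =
      g p (cov (christoffelL g) X p w) (Y p) + g p (X p) (cov (christoffelL g) Y p w) := by
  have h1 : DifferentiableAt ℝ g p := (hg.smooth p hp).differentiableAt (by simp)
  rw [fderiv_clm_apply (h1.clm_apply hX) hY, fderiv_clm_apply h1 hX]
  simp only [add_apply, ContinuousLinearMap.comp_apply, ContinuousLinearMap.flip_apply,
    hg.compat hp, cov, map_add]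
  ring

theorem differentiable_christoffel {p : E} (hp : p ∈ U) (u v : E) :
    DifferentiableAt ℝ (fun q => christoffelL g q u v) p :=
  (((hg.smooth_christoffel hp).differentiableAt (by simp)).clm_apply
    (differentiableAt_const u)).clm_apply (differentiableAt_const v)

/-- Differentiate `compat` again and use symmetry of the second derivatives of `g`: the products of
two Christoffel terms are symmetric in `u`, `v` and cancel. -/
theorem curv_skew {p : E} (hp : p ∈ U) (u v w z : E) :
    g p (curv (christoffelL g) p u v w) z = -g p w (curv (christoffelL g) p u v z) := by
  have h2 : DifferentiableAt ℝ (fderiv ℝ g) p :=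
    ((hg.smooth p hp).fderiv_right (m := ∞) (by simp)).differentiableAt (by simp)
  have e : ∀ a b : E, fderiv ℝ (fderiv ℝ g) p a b w z =
      g p (cov (christoffelL g) (fun q => christoffelL g q b w) p a) z +
        g p (christoffelL g p b w) (christoffelL g p a z) +
        (g p (christoffelL g p a w) (christoffelL g p b z) +
        g p w (cov (christoffelL g) (fun q => christoffelL g q b z) p a)) := fun a b => by
    have h3 : DifferentiableAt ℝ (fun q => fderiv ℝ g q b) p :=
      h2.clm_apply (differentiableAt_const b)
    have h1 : DifferentiableAt ℝ g p := (hg.smooth p hp).differentiableAt (by simp)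
    rw [← fderiv_clm_apply_const h2, ← fderiv_clm_apply_const h3,
      ← fderiv_clm_apply_const (h3.clm_apply (differentiableAt_const w))]
    have h4 : (fun q => fderiv ℝ g q b w z) =ᶠ[nhds p] fun q =>
        g q (christoffelL g q b w) z + g q w (christoffelL g q b z) :=
      (hg.eventually hp).mono fun q hq => hg.compat hq b w z
    have d1 := hg.differentiable_christoffel hp b w
    have d2 := hg.differentiable_christoffel hp b z
    rw [h4.fderiv_eq, fderiv_fun_add
      ((h1.clm_apply d1).clm_apply (differentiableAt_const z))
      ((h1.clm_apply (differentiableAt_const w)).clm_apply d2), add_apply,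
      hg.fderiv_apply hp d1 (differentiableAt_const z),
      hg.fderiv_apply hp (differentiableAt_const w) d2, cov_const, cov_const]
  have hs : fderiv ℝ (fderiv ℝ g) p u v = fderiv ℝ (fderiv ℝ g) p v u :=
    (hg.smooth p hp).isSymmSndFDerivAt (by simp [ENat.LEInfty.out]) u v
  have h := congrArg (fun f : E →L[ℝ] E →L[ℝ] ℝ => f w z) hs
  simp only [e] at h
  simp only [curv, map_sub, sub_apply]
  linarith

/-- Covariant differentiation commutes with the metric trace. -/
theorem cov_trace {p : E} (hp : p ∈ U) {β : E → (E →L[ℝ] E →L[ℝ] E)}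
    (hβ : DifferentiableAt ℝ β p) {ι : Type*} [Fintype ι] {b : ι → E} {c : E → ι → E}
    (hc : ∀ i, DifferentiableAt ℝ (fun q => c q i) p)
    (hbc : ∀ q ∈ U, IsDualPair (g q) b (c q))
    (hconst : ∀ q ∈ U, ∀ i x, g q (c q i) x = g p (c p i) x) (w : E) :
    cov (christoffelL g) (fun q => ∑ i, β q (b i) (c q i)) p w =
      ∑ i, covBilin (christoffelL g) β p w (b i) (c p i) := by
  have H := hbc p hp
  -- The covector dual to `c q i` does not depend on `q`, so only the Christoffel term of the
  -- constant field `x` survives.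
  have h1 : ∀ i x, g p (cov (christoffelL g) (fun q => c q i) p w) x =
      -g p (c p i) (christoffelL g p w x) := fun i x => by
    have h : (fun q => g q (c q i) x) =ᶠ[nhds p] fun _ => g p (c p i) x :=
      (hg.eventually hp).mono fun q hq => hconst q hq i x
    have h2 := hg.fderiv_apply hp (hc i) (differentiableAt_const x) w
    rw [h.fderiv_eq, cov_const] at h2
    simp at h2
    linarith
  -- The motion of the dual family exactly compensates for the constant fields `b i` not being
  -- parallel.
  have h2 : ∑ i, β p (b i) (cov (christoffelL g) (fun q => c q i) p w) =
      -∑ i, β p (christoffelL g p w (b i)) (c p i) := by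
    have e1 : ∀ i, β p (b i) (cov (christoffelL g) (fun q => c q i) p w) =
        -∑ j, g p (c p i) (christoffelL g p w (b j)) • β p (b i) (c p j) := fun i => by
      rw [← H.swap.sum_apply_left (f := fun x => β p (b i) x) ⟨by simp, by simp⟩
        (cov (christoffelL g) (fun q => c q i) p w), ← Finset.sum_neg_distrib]
      exact Finset.sum_congr rfl fun j _ => by rw [h1, neg_smul]
    have e2 : ∀ j, β p (christoffelL g p w (b j)) (c p j) =
        ∑ i, g p (c p i) (christoffelL g p w (b j)) • β p (b i) (c p j) := fun j => by
      rw [← H.sum_apply_left (f := fun x => β p x (c p j)) ⟨by simp, by simp⟩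
        (christoffelL g p w (b j))]
      exact Finset.sum_congr rfl fun i _ => by rw [H.symm]
    simp only [e1, e2, Finset.sum_neg_distrib]
    rw [Finset.sum_comm]
  have h3 : ∀ i, DifferentiableAt ℝ (fun q => β q (b i)) p := fun i =>
    hβ.clm_apply (differentiableAt_const (b i))
  have h4 : cov (christoffelL g) (fun q => ∑ i, β q (b i) (c q i)) p w =
      ∑ i, cov (christoffelL g) (fun q => β q (b i) (c q i)) p w := by
    simp only [cov]
    rw [fderiv_fun_sum fun i _ => (h3 i).clm_apply (hc i)]
    simp [Finset.sum_add_distrib]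
  have h5 : ∀ i, cov (christoffelL g) (fun q => β q (b i) (c q i)) p w =
      covBilin (christoffelL g) β p w (b i) (c p i) + β p (christoffelL g p w (b i)) (c p i) +
        β p (b i) (cov (christoffelL g) (fun q => c q i) p w) := fun i => by
    simp only [cov, covBilin]
    rw [fderiv_clm_apply (h3 i) (hc i)]
    simp only [add_apply, ContinuousLinearMap.comp_apply, ContinuousLinearMap.flip_apply, map_add]
    rw [fderiv_clm_apply_const hβ]
    abel
  rw [h4, Finset.sum_congr rfl fun i _ => h5 i, Finset.sum_add_distrib, Finset.sum_add_distrib, h2]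
  abel

end IsMetricOn

end LeviCivita

/-! ### Differentiating the structure equations on an open set. -/

section LocalStructure

set_option maxSynthPendingDepth 3

variable {E : Type*} [NormedAddCommGroup E] [NormedSpace ℝ E]

/-- A (para)contact metric structure on an open subset `U` of a vector space. -/
structure IsParacontactOn (U : Set E) (g : E → (E →L[ℝ] E →L[ℝ] ℝ)) (φ : E → (E →L[ℝ] E))
    (ξ : E → E) (η : E → (E →L[ℝ] ℝ)) (ε₀ ε₁ : ℝ) : Prop extends IsMetricOn U g where
  smooth_φ : ∀ p ∈ U, ContDiffAt ℝ ∞ φ p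
  smooth_ξ : ∀ p ∈ U, ContDiffAt ℝ ∞ ξ p
  smooth_η : ∀ p ∈ U, ContDiffAt ℝ ∞ η p
  sq₀ : ε₀ * ε₀ = 1
  sq₁ : ε₁ * ε₁ = 1
  φ_sq : ∀ p ∈ U, ∀ u, φ p (φ p u) = ε₁ • (u - η p u • ξ p)
  η_ξ : ∀ p ∈ U, η p (ξ p) = 1
  g_φ : ∀ p ∈ U, ∀ u v, g p (φ p u) (φ p v) = -ε₁ * (g p u v - ε₀ * (η p u * η p v))
  contact : ∀ p ∈ U, ∀ u v, extDer η p u v = g p u (φ p v)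

namespace IsParacontactOn

variable {U : Set E} {g : E → (E →L[ℝ] E →L[ℝ] ℝ)} {φ : E → (E →L[ℝ] E)}
  {ξ : E → E} {η : E → (E →L[ℝ] ℝ)} {ε₀ ε₁ : ℝ} (S : IsParacontactOn U g φ ξ η ε₀ ε₁)
  {p : E} (hp : p ∈ U)
include S

theorem smul_inj₁ {V : Type*} [AddCommGroup V] [Module ℝ V] {x : V} (h : ε₁ • x = 0) : x = 0 := by
  have := congrArg (fun y => ε₁ • y) h
  simpa only [smul_smul, S.sq₁, one_smul, smul_zero] using this

include hp

/-- Since φ²ξ = 0, also φ²(φξ) = 0, which forces φξ = aξ with a = η(φξ); then 0 = φ²ξ = a²ξ gives a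
= 0. -/
theorem φ_ξ : φ p (ξ p) = 0 := by
  have h1 : φ p (φ p (ξ p)) = 0 := by rw [S.φ_sq p hp, S.η_ξ p hp]; simp
  have h2 := S.φ_sq p hp (φ p (ξ p))
  rw [h1, map_zero] at h2
  have h3 := sub_eq_zero.mp (S.smul_inj₁ h2.symm)
  have h4 : η p (φ p (ξ p)) * η p (φ p (ξ p)) = 0 := by
    have h5 := h1
    rw [h3, map_smul, h3, smul_smul] at h5
    have h6 := congrArg (η p) h5
    rwa [map_smul, S.η_ξ p hp, map_zero, smul_eq_mul, mul_one, map_smul, S.η_ξ p hp,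
      smul_eq_mul, mul_one] at h6
  rw [h3, mul_self_eq_zero.mp h4, zero_smul]

theorem η_φ (u : E) : η p (φ p u) = 0 := by
  have h1 := S.φ_sq p hp (φ p u)
  rw [S.φ_sq p hp u, map_smul, map_sub, map_smul, S.φ_ξ hp, smul_zero, sub_zero, smul_sub] at h1
  have h2 := congrArg (η p) (S.smul_inj₁ (sub_eq_self.mp h1.symm))
  rwa [map_smul, S.η_ξ p hp, map_zero, smul_eq_mul, mul_one] at h2

theorem η_eq (u : E) : η p u = ε₀ * g p (ξ p) u := by
  have h := S.g_φ p hp (ξ p) u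
  rw [S.φ_ξ hp, S.η_ξ p hp] at h
  simp at h
  have h0 := S.sq₀
  rcases h with h | h
  · have := S.sq₁; rw [h] at this; simp at this
  · linear_combination (-ε₀) * h + (-η p u) * h0

theorem φ_skew (u v : E) : g p (φ p u) v = -g p u (φ p v) := by
  have h1 := S.g_φ p hp u (φ p v)
  have h2 := S.η_eq hp (φ p u)
  have h3 : g p (φ p u) (ξ p) = 0 := by
    rw [S.η_φ hp] at h2
    rw [S.symm p hp]
    linear_combination (-ε₀) * h2 - g p (ξ p) (φ p u) * S.sq₀
  rw [S.φ_sq p hp v, map_smul, map_sub, map_smul, h3, S.η_φ hp, smul_eq_mul, smul_eq_mul] at h1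
  linear_combination ε₁ * h1 - (g p (φ p u) v + g p u (φ p v)) * S.sq₁

theorem ξ_ξ : g p (ξ p) (ξ p) = ε₀ := by
  have h := S.η_eq hp (ξ p)
  rw [S.η_ξ p hp] at h
  linear_combination (-ε₀) * h - g p (ξ p) (ξ p) * S.sq₀

theorem diff_g : DifferentiableAt ℝ g p := (S.smooth p hp).differentiableAt (by simp)

theorem diff_φ : DifferentiableAt ℝ φ p := (S.smooth_φ p hp).differentiableAt (by simp)

theorem diff_ξ : DifferentiableAt ℝ ξ p := (S.smooth_ξ p hp).differentiableAt (by simp)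

theorem diff_η : DifferentiableAt ℝ η p := (S.smooth_η p hp).differentiableAt (by simp)

theorem diff_φ_apply (v : E) : DifferentiableAt ℝ (fun q => φ q v) p :=
  (S.diff_φ hp).clm_apply (differentiableAt_const v)

theorem diff_g_ξ (v : E) : DifferentiableAt ℝ (fun q => g q (ξ q) v) p :=
  ((S.diff_g hp).clm_apply (S.diff_ξ hp)).clm_apply (differentiableAt_const v)

theorem cov_φ_apply (w v : E) : cov (christoffelL g) (fun q => φ q v) p w =
    covEnd (christoffelL g) φ p w v + φ p (christoffelL g p w v) := by
  rw [cov_end_apply (S.diff_φ hp) (differentiableAt_const v), cov_const]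

theorem C_ξ (u : E) : covEnd (christoffelL g) φ p u (ξ p) =
    -φ p (covVec (christoffelL g) ξ p u) := by
  have h : (fun q => φ q (ξ q)) =ᶠ[nhds p] fun _ => 0 :=
    (S.eventually hp).mono fun q hq => S.φ_ξ hq
  have h2 := cov_congr (Γ := christoffelL g) h u
  rw [cov_end_apply (S.diff_φ hp) (S.diff_ξ hp), cov_const, map_zero] at h2
  exact eq_neg_of_add_eq_zero_left h2

variable [FiniteDimensional ℝ E]

theorem A_orth (u : E) : g p (covVec (christoffelL g) ξ p u) (ξ p) = 0 := by
  have h : (fun q => g q (ξ q) (ξ q)) =ᶠ[nhds p] fun _ => ε₀ :=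
    (S.eventually hp).mono fun q hq => S.ξ_ξ hq
  have h2 := S.fderiv_apply hp (S.diff_ξ hp) (S.diff_ξ hp) u
  rw [h.fderiv_eq, S.symm p hp (ξ p)] at h2
  simp at h2
  rw [covVec_apply]; linarith

theorem fderiv_η (u v : E) : fderiv ℝ η p u v =
    ε₀ * (g p (covVec (christoffelL g) ξ p u) v + g p (ξ p) (christoffelL g p u v)) := by
  have h : (fun q => η q v) =ᶠ[nhds p] fun q => ε₀ * g q (ξ q) v :=
    (S.eventually hp).mono fun q hq => S.η_eq hq v
  rw [← fderiv_clm_apply_const (S.diff_η hp), h.fderiv_eq,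
    fderiv_const_mul (S.diff_g_ξ hp v), smul_apply, smul_eq_mul,
    S.fderiv_apply hp (S.diff_ξ hp) (differentiableAt_const v), cov_const, covVec_apply]

/-- The Christoffel terms in dη cancel by symmetry; the 2 undoes the factor ½ in `extDer`. -/
theorem A_skew (u v : E) : g p (covVec (christoffelL g) ξ p u) v -
    g p u (covVec (christoffelL g) ξ p v) = 2 * ε₀ * g p u (φ p v) := by
  have h := S.contact p hp u v
  rw [extDer, S.fderiv_η hp, S.fderiv_η hp, S.christoffel_symm hp v u] at h
  rw [← h, S.symm p hp u]
  linear_combination (g p (covVec (christoffelL g) ξ p v) u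
    - g p (covVec (christoffelL g) ξ p u) v) * S.sq₀

theorem C_skew (u v w : E) : g p (covEnd (christoffelL g) φ p u v) w =
    -g p v (covEnd (christoffelL g) φ p u w) := by
  have h : (fun q => g q (φ q v) w + g q v (φ q w)) =ᶠ[nhds p] fun _ => 0 :=
    (S.eventually hp).mono fun q hq => by simp only [S.φ_skew hq]; ring
  have d1 : DifferentiableAt ℝ (fun q => g q (φ q v) w) p :=
    ((S.diff_g hp).clm_apply (S.diff_φ_apply hp v)).clm_apply (differentiableAt_const w)
  have d2 : DifferentiableAt ℝ (fun q => g q v (φ q w)) p :=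
    ((S.diff_g hp).clm_apply (differentiableAt_const v)).clm_apply (S.diff_φ_apply hp w)
  have h2 := congrArg (fun f : E →L[ℝ] ℝ => f u) h.fderiv_eq
  simp only [fderiv_fun_add d1 d2, add_apply,
    S.fderiv_apply hp (S.diff_φ_apply hp v) (differentiableAt_const w),
    S.fderiv_apply hp (differentiableAt_const v) (S.diff_φ_apply hp w), cov_const,
    S.cov_φ_apply hp, map_add, fderiv_const_apply, _root_.zero_apply] at h2
  linear_combination h2 - S.φ_skew hp (christoffelL g p u v) w
    - S.φ_skew hp v (christoffelL g p u w)

theorem C_φ (u v : E) : covEnd (christoffelL g) φ p u (φ p v) +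
    φ p (covEnd (christoffelL g) φ p u v) = -(ε₁ * ε₀) •
      (g p (covVec (christoffelL g) ξ p u) v • ξ p +
        g p (ξ p) v • covVec (christoffelL g) ξ p u) := by
  have h : (fun q => φ q (φ q v)) =ᶠ[nhds p] fun q => ε₁ • (v - (ε₀ * g q (ξ q) v) • ξ q) :=
    (S.eventually hp).mono fun q hq => by simp only [S.φ_sq q hq, S.η_eq hq]
  have h2 := cov_congr (Γ := christoffelL g) h u
  have d1 : DifferentiableAt ℝ (fun q => ε₀ * g q (ξ q) v) p := (S.diff_g_ξ hp v).const_mul ε₀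
  rw [cov_end_apply (S.diff_φ hp) (S.diff_φ_apply hp v), S.cov_φ_apply hp,
    cov_const_smul _ ((differentiableAt_const v).fun_sub (d1.fun_smul (S.diff_ξ hp))),
    cov_sub (differentiableAt_const v) (d1.fun_smul (S.diff_ξ hp)), cov_const,
    cov_smul_field d1 (S.diff_ξ hp), fderiv_const_mul (S.diff_g_ξ hp v), smul_apply, smul_eq_mul,
    S.fderiv_apply hp (S.diff_ξ hp) (differentiableAt_const v), cov_const, map_add,
    S.φ_sq p hp, S.η_eq hp, ← covVec_apply] at h2
  linear_combination (norm := module) h2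

/-- This is d(dη) = 0 in covariant form: in the cyclic sum of the derivatives of the contact
condition, second derivatives of `η` cancel, and Christoffel terms cancel by their symmetry and
skewness of `φ`. -/
theorem cyclic (u v w : E) : g p u (covEnd (christoffelL g) φ p w v) +
    g p v (covEnd (christoffelL g) φ p u w) + g p w (covEnd (christoffelL g) φ p v u) = 0 := by
  have hη2 : DifferentiableAt ℝ (fderiv ℝ η) p :=
    ((S.smooth_η p hp).fderiv_right (m := ∞) (by simp)).differentiableAt (by simp)
  have hs : ∀ x y, fderiv ℝ (fderiv ℝ η) p x y = fderiv ℝ (fderiv ℝ η) p y x :=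
    (S.smooth_η p hp).isSymmSndFDerivAt (by simp [ENat.LEInfty.out])
  have e : ∀ a x y : E, 1 / 2 * (fderiv ℝ (fderiv ℝ η) p a x y - fderiv ℝ (fderiv ℝ η) p a y x) =
      g p x (covEnd (christoffelL g) φ p a y) + g p x (φ p (christoffelL g p a y)) +
        g p (christoffelL g p a x) (φ p y) := fun a x y => by
    have h : (fun q => 1 / 2 * (fderiv ℝ η q x y - fderiv ℝ η q y x)) =ᶠ[nhds p]
        fun q => g q x (φ q y) := (S.eventually hp).mono fun q hq => S.contact q hq x y
    have d : ∀ x, DifferentiableAt ℝ (fun q => fderiv ℝ η q x) p := fun x =>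
      hη2.clm_apply (differentiableAt_const x)
    have h2 := congrArg (fun f : E →L[ℝ] ℝ => f a) h.fderiv_eq
    rw [fderiv_const_mul (((d x).clm_apply (differentiableAt_const y)).fun_sub
      ((d y).clm_apply (differentiableAt_const x))),
      fderiv_fun_sub ((d x).clm_apply (differentiableAt_const y))
      ((d y).clm_apply (differentiableAt_const x)), smul_apply, sub_apply,
      fderiv_clm_apply_const (d x), fderiv_clm_apply_const (d y), fderiv_clm_apply_const hη2,
      fderiv_clm_apply_const hη2, S.fderiv_apply hp (differentiableAt_const x)
      (S.diff_φ_apply hp y), cov_const, S.cov_φ_apply hp, map_add, smul_eq_mul] at h2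
    linear_combination h2
  have e1 := e w u v
  have e2 := e u v w
  have e3 := e v w u
  rw [hs w u] at e1
  rw [hs u v] at e2
  rw [hs v w, ] at e3
  have s1 := S.φ_skew hp (christoffelL g p w u) v
  have s2 := S.φ_skew hp (christoffelL g p u v) w
  have s3 := S.φ_skew hp (christoffelL g p v w) u
  rw [S.symm p hp, S.christoffel_symm hp w u] at s1
  rw [S.symm p hp, S.christoffel_symm hp u v] at s2
  rw [S.symm p hp, S.christoffel_symm hp v w] at s3
  rw [S.christoffel_symm hp w u] at e1
  rw [S.christoffel_symm hp u v] at e2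
  rw [S.christoffel_symm hp v w] at e3
  linear_combination -e1 - e2 - e3 - s1 - s2 - s3

theorem firstOrder : FirstOrderRelations (g p) (φ p) (ξ p) (covVec (christoffelL g) ξ p)
    (covEnd (christoffelL g) φ p) ε₀ ε₁ where
  sq₀ := S.sq₀
  sq₁ := S.sq₁
  φ_sq u := by rw [S.φ_sq p hp, S.η_eq hp]
  φ_ξ := S.φ_ξ hp
  φ_skew := S.φ_skew hp
  ξ_ξ := S.ξ_ξ hp
  A_orth := S.A_orth hp
  A_skew := S.A_skew hp
  C_skew := S.C_skew hp
  C_φ := S.C_φ hp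
  C_ξ := S.C_ξ hp
  cyclic := S.cyclic hp

theorem dualPair : IsDualPair (g p) (Module.finBasis ℝ E) fun i =>
    (g p).inverse (LinearMap.toContinuousLinearMap ((Module.finBasis ℝ E).coord i)) :=
  isDualPair_finBasis (S.symm p hp) (S.nondeg p hp)

theorem N_skew (w u v z : E) :
    g p (covBilin (christoffelL g) (covEnd (christoffelL g) φ) p w u v) z =
      -g p v (covBilin (christoffelL g) (covEnd (christoffelL g) φ) p w u z) := by
  have hC : DifferentiableAt ℝ (covEnd (christoffelL g) φ) p :=
    (contDiffAt_covEnd (S.smooth_φ p hp) (S.smooth_christoffel hp)).differentiableAt (by simp)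
  have dC : ∀ y, DifferentiableAt ℝ (fun q => covEnd (christoffelL g) φ q u y) p := fun y =>
    (hC.clm_apply (differentiableAt_const u)).clm_apply (differentiableAt_const y)
  have h : (fun q => g q (covEnd (christoffelL g) φ q u v) z +
      g q v (covEnd (christoffelL g) φ q u z)) =ᶠ[nhds p] fun _ => 0 :=
    (S.eventually hp).mono fun q hq => by simp only [S.C_skew hq]; ring
  have d1 : DifferentiableAt ℝ (fun q => g q (covEnd (christoffelL g) φ q u v) z) p :=
    ((S.diff_g hp).clm_apply (dC v)).clm_apply (differentiableAt_const z)
  have d2 : DifferentiableAt ℝ (fun q => g q v (covEnd (christoffelL g) φ q u z)) p :=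
    ((S.diff_g hp).clm_apply (differentiableAt_const v)).clm_apply (dC z)
  have h2 := congrArg (fun f : E →L[ℝ] ℝ => f w) h.fderiv_eq
  simp only [fderiv_fun_add d1 d2, add_apply,
    S.fderiv_apply hp (dC v) (differentiableAt_const z),
    S.fderiv_apply hp (differentiableAt_const v) (dC z), cov_const,
    cov_bilin_apply hC, map_add, fderiv_const_apply, _root_.zero_apply] at h2
  linear_combination h2 - S.C_skew hp (christoffelL g p w u) v z
    - S.C_skew hp u (christoffelL g p w v) z - S.C_skew hp u v (christoffelL g p w z)

theorem cov_sum {β : E → (E →L[ℝ] E →L[ℝ] E)} (hβ : DifferentiableAt ℝ β p) (w : E) :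
    cov (christoffelL g) (fun q => ∑ i, β q (Module.finBasis ℝ E i) ((g q).inverse
      (LinearMap.toContinuousLinearMap ((Module.finBasis ℝ E).coord i)))) p w =
      ∑ i, covBilin (christoffelL g) β p w (Module.finBasis ℝ E i) ((g p).inverse
        (LinearMap.toContinuousLinearMap ((Module.finBasis ℝ E).coord i))) := by
  have : CompleteSpace E := FiniteDimensional.complete ℝ E
  have hI : ContDiffAt ℝ ∞ (fun q => (g q).inverse) p :=
    ((isInvertible_of_nondeg (S.nondeg p hp)).contDiffAt_map_inverse).comp p (S.smooth p hp)
  refine S.cov_trace hp hβ (fun i => (hI.differentiableAt (by simp)).clm_apply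
    (differentiableAt_const _)) (fun q hq => S.dualPair hq) (fun q hq i x => ?_) w
  rw [(isInvertible_of_nondeg (S.nondeg q hq)).self_apply_inverse,
    (isInvertible_of_nondeg (S.nondeg p hp)).self_apply_inverse]

theorem secondOrder : SecondOrderRelations (g p) (φ p) (ξ p) (covVec (christoffelL g) ξ p)
    (covEnd (christoffelL g) φ p) (Module.finBasis ℝ E) (fun i => (g p).inverse
      (LinearMap.toContinuousLinearMap ((Module.finBasis ℝ E).coord i)))
    ε₁ (Module.finrank ℝ E - 1) (riemann g p)
    (covBilin (christoffelL g) (covEnd (christoffelL g) φ) p) := by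
  have hφ := S.smooth_φ p hp
  have hξ := S.smooth_ξ p hp
  have hΓ := S.smooth_christoffel hp
  have hΓ1 : DifferentiableAt ℝ (christoffelL g) p := hΓ.differentiableAt (by simp)
  have hs := S.christoffel_symm hp
  have hC : DifferentiableAt ℝ (covEnd (christoffelL g) φ) p :=
    (contDiffAt_covEnd hφ hΓ).differentiableAt (by simp)
  have hA : DifferentiableAt ℝ (covVec (christoffelL g) ξ) p :=
    (contDiffAt_covVec hξ hΓ).differentiableAt (by simp)
  constructor
  case R_lin =>
    intro v w
    have h : ∀ u, riemann g p u v w = fderiv ℝ (christoffelL g) p u v w -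
        fderiv ℝ (christoffelL g) p v u w + christoffelL g p u (christoffelL g p v w) -
          christoffelL g p v (christoffelL g p u w) := fun u => by
      have e : ∀ a b, fderiv ℝ (fun q => christoffel g q b w) p a =
          fderiv ℝ (christoffelL g) p a b w := fun a b => by
        rw [← fderiv_clm_apply_const hΓ1,
          ← fderiv_clm_apply_const (hΓ1.clm_apply (differentiableAt_const b))]
        rfl
      rw [riemann, e, e]; rfl
    simp only [h]
    exact ⟨fun x y => by simp only [map_add, add_apply]; abel,
      fun a x => by simp only [map_smul, smul_apply]; module⟩
  case R_swap => intro u v w; simp only [riemann_eq_curv, curv]; abel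
  case R_skew => intro u v w z; simp only [riemann_eq_curv]; exact S.curv_skew hp u v w z
  case ricci_φ =>
    intro u v w
    simp only [riemann_eq_curv]
    exact ricci_identity_end hφ hΓ hs u v w
  case N_skew => exact S.N_skew hp
  case sum_N =>
    intro w
    -- `sum_C` holds at every point of `U` with a constant coefficient, so it may be differentiated.
    rw [← S.cov_sum hp hC w, covVec_apply, ← cov_const_smul _ (S.diff_ξ hp)]
    refine cov_congr ((S.eventually hp).mono fun q hq => ?_) w
    simp only [(S.firstOrder hq).sum_C (S.dualPair hq), sum_finBasis (S.symm q hq) (S.nondeg q hq)]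
  case sum_N_φ =>
    intro w
    -- The field (u, v) ↦ (∇_uφ)(φv) has zero trace on `U` by `sum_C_φ`; the product rule for its
    -- derivative gives the two sums.
    have hβ : DifferentiableAt ℝ (fun q => (ContinuousLinearMap.compL ℝ E E E).flip (φ q) ∘L
        covEnd (christoffelL g) φ q) p :=
      (((ContinuousLinearMap.compL ℝ E E E).flip.differentiableAt).comp p (S.diff_φ hp)).clm_comp hC
    have h := S.cov_sum hp hβ w
    have e : ∀ u v, covBilin (christoffelL g) (fun q => (ContinuousLinearMap.compL ℝ E E E).flip
        (φ q) ∘L covEnd (christoffelL g) φ q) p w u v =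
        covBilin (christoffelL g) (covEnd (christoffelL g) φ) p w u (φ p v) +
          covEnd (christoffelL g) φ p u (covEnd (christoffelL g) φ p w v) := fun u v => by
      have hCu : DifferentiableAt ℝ (fun q => covEnd (christoffelL g) φ q u) p :=
        hC.clm_apply (differentiableAt_const u)
      have h1 := cov_bilin_apply (Γ := christoffelL g) hβ w u v
      have h2 : (fun q => ((ContinuousLinearMap.compL ℝ E E E).flip (φ q) ∘L
          covEnd (christoffelL g) φ q) u v) = fun q => covEnd (christoffelL g) φ q u (φ q v) := rfl
      rw [h2, cov, fderiv_clm_apply hCu (S.diff_φ_apply hp v), add_apply,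
        ContinuousLinearMap.comp_apply, ContinuousLinearMap.flip_apply,
        fderiv_clm_apply_const hC, fderiv_clm_apply_const (S.diff_φ hp)] at h1
      rw [← sub_eq_iff_eq_add, ← sub_eq_iff_eq_add] at h1
      rw [← h1, covBilin, covEnd_apply φ p w v, map_sub, map_add]
      simp only [ContinuousLinearMap.comp_apply, ContinuousLinearMap.flip_apply,
        ContinuousLinearMap.compL_apply]
      abel
    have h0 : cov (christoffelL g) (fun q => ∑ i, ((ContinuousLinearMap.compL ℝ E E E).flip
        (φ q) ∘L covEnd (christoffelL g) φ q) (Module.finBasis ℝ E i) ((g q).inverse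
        (LinearMap.toContinuousLinearMap ((Module.finBasis ℝ E).coord i)))) p w = 0 := by
      have h1 := cov_congr (Γ := christoffelL g) ((S.eventually hp).mono fun q hq =>
        (S.firstOrder hq).sum_C_φ (S.dualPair hq)) w
      rw [cov_const, map_zero] at h1
      exact h1
    rw [h0, Finset.sum_congr rfl fun i _ => e _ _, Finset.sum_add_distrib] at h
    exact eq_neg_of_add_eq_zero_left h.symm
  case ricci_ξ =>
    have hc : ∀ q ∈ U, ∀ i v, g q ((g q).inverse (LinearMap.toContinuousLinearMap
        ((Module.finBasis ℝ E).coord i))) v = (Module.finBasis ℝ E).coord i v := fun q hq i v => by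
      rw [(isInvertible_of_nondeg (S.nondeg q hq)).self_apply_inverse]; rfl
    have H := S.dualPair hp
    -- Differentiating Aξ = 0 along `u` gives (∇_uA)ξ = -A(Au).
    have e : ∀ u, riemann g p u (ξ p) (ξ p) = -covVec (christoffelL g) ξ p
        (covVec (christoffelL g) ξ p u) - covEnd (christoffelL g) (covVec (christoffelL g) ξ) p
          (ξ p) u := fun u => by
      rw [riemann_eq_curv, curv, ricci_identity_vec hξ hΓ hs]
      have h1 := cov_congr (Γ := christoffelL g) ((S.eventually hp).mono fun q hq =>
        (S.firstOrder hq).A_ξ (S.dualPair hq)) u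
      rw [cov_const, map_zero, cov_end_apply hA (S.diff_ξ hp)] at h1
      rw [eq_neg_of_add_eq_zero_left h1]; rfl
    have h1 : ∑ i, (Module.finBasis ℝ E).coord i
        (fderiv ℝ (covVec (christoffelL g) ξ) p (ξ p) (Module.finBasis ℝ E i)) = 0 := by
      have h2 : (fun q => ∑ i, (LinearMap.toContinuousLinearMap ((Module.finBasis ℝ E).coord i))
          (covVec (christoffelL g) ξ q (Module.finBasis ℝ E i))) =ᶠ[nhds p] fun _ => 0 := by
        refine (S.eventually hp).mono fun q hq => ?_
        have h3 := (S.firstOrder hq).trace_A (S.dualPair hq)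
        simp only [S.symm q hq (covVec _ _ _ _), hc q hq] at h3
        exact h3
      have d : ∀ i, DifferentiableAt ℝ (fun q => covVec (christoffelL g) ξ q
          (Module.finBasis ℝ E i)) p := fun i => hA.clm_apply (differentiableAt_const _)
      have h4 := congrArg (fun f : E →L[ℝ] ℝ => f (ξ p)) h2.fderiv_eq
      have d' : ∀ i, DifferentiableAt ℝ (fun q => (LinearMap.toContinuousLinearMap
          ((Module.finBasis ℝ E).coord i)) (covVec (christoffelL g) ξ q
            (Module.finBasis ℝ E i))) p := fun i =>
        (ContinuousLinearMap.differentiableAt _).comp p (d i)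
      rw [fderiv_fun_sum fun i _ => d' i] at h4
      rw [sum_apply, fderiv_const_apply, _root_.zero_apply] at h4
      rw [← h4]
      refine Finset.sum_congr rfl fun i _ => ?_
      have h5 := ((LinearMap.toContinuousLinearMap
        ((Module.finBasis ℝ E).coord i)).hasFDerivAt.comp p (d i).hasFDerivAt).fderiv
      refine Eq.trans ?_ (congrArg (fun f : E →L[ℝ] ℝ => f (ξ p)) h5.symm)
      rw [ContinuousLinearMap.comp_apply, fderiv_clm_apply_const hA]; rfl
    -- The Christoffel part of ∇_ξA is a commutator, hence traceless; its derivative part is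
    -- traceless by `h1`.
    have h2 := H.trace_comm (christoffelL g p (ξ p)) (covVec (christoffelL g) ξ p)
    simp only [S.symm p hp _ ((g p).inverse _), hc p hp] at h2
    simp only [hc p hp, S.symm p hp _ ((g p).inverse _), e, covEnd_apply, map_sub, map_add, map_neg,
      Finset.sum_sub_distrib, Finset.sum_add_distrib, Finset.sum_neg_distrib, h1, h2]
    ring

end IsParacontactOn

end LocalStructure

/-! ### From tensor fields on the manifold to their chart expressions. -/

section Transfer

set_option maxSynthPendingDepth 3

variable {E : Type*} [NormedAddCommGroup E] [NormedSpace ℝ E]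
  {M : Type*} [TopologicalSpace M] [ChartedSpace E M] [IsManifold 𝓘(ℝ, E) ∞ M]

/-- Smoothness of a section is expressed in bundle trivializations; this links it to the coordinate
expressions defined by differentials of charts. -/
theorem chartPush_eq (x₀ : M) {p : E} (hp : p ∈ (extChartAt 𝓘(ℝ, E) x₀).target) :
    chartPush x₀ p = (trivializationAt E (TangentSpace 𝓘(ℝ, E)) x₀).continuousLinearMapAt ℝ
      ((extChartAt 𝓘(ℝ, E) x₀).symm p) := by
  have : IsManifold 𝓘(ℝ, E) 1 M := .of_le (n := ∞) (by simp)
  have h := (extChartAt 𝓘(ℝ, E) x₀).map_target hp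
  rw [extChartAt_source] at h
  exact (TangentBundle.continuousLinearMapAt_trivializationAt h).symm

theorem chartPull_eq (x₀ : M) {p : E} (hp : p ∈ (extChartAt 𝓘(ℝ, E) x₀).target) :
    chartPull x₀ p = (trivializationAt E (TangentSpace 𝓘(ℝ, E)) x₀).symmL ℝ
      ((extChartAt 𝓘(ℝ, E) x₀).symm p) := by
  have : IsManifold 𝓘(ℝ, E) 1 M := .of_le (n := ∞) (by simp)
  have h := (extChartAt 𝓘(ℝ, E) x₀).map_target hp
  rw [extChartAt_source] at h
  rw [TangentBundle.symmL_trivializationAt h, (extChartAt 𝓘(ℝ, E) x₀).right_inv hp]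
  simp only [modelWithCornersSelf_coe, Set.range_id, mfderivWithin_univ]
  rfl

theorem symm_mem_baseSet (x₀ : M) {p : E} (hp : p ∈ (extChartAt 𝓘(ℝ, E) x₀).target) :
    (extChartAt 𝓘(ℝ, E) x₀).symm p ∈
      (trivializationAt E (TangentSpace 𝓘(ℝ, E) : M → Type _) x₀).baseSet := by
  have h := (extChartAt 𝓘(ℝ, E) x₀).map_target hp
  rw [extChartAt_source] at h
  simpa using h

theorem chartPush_chartPull (x₀ : M) {p : E} (hp : p ∈ (extChartAt 𝓘(ℝ, E) x₀).target) (u : E) :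
    chartPush x₀ p (chartPull x₀ p u) = u := by
  rw [chartPush_eq x₀ hp, chartPull_eq x₀ hp]
  exact Trivialization.continuousLinearMapAt_symmL _ (symm_mem_baseSet x₀ hp) u

theorem chartPull_chartPush (x₀ : M) {p : E} (hp : p ∈ (extChartAt 𝓘(ℝ, E) x₀).target)
    (u : TangentSpace 𝓘(ℝ, E) ((extChartAt 𝓘(ℝ, E) x₀).symm p)) :
    chartPull x₀ p (chartPush x₀ p u) = u := by
  rw [chartPush_eq x₀ hp, chartPull_eq x₀ hp]
  exact Trivialization.symmL_continuousLinearMapAt _ (symm_mem_baseSet x₀ hp) u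

/-- A smooth section of a vector bundle over `M`, read in a trivialization and in the chart at
`x₀`, is a smooth map. -/
theorem contDiffAt_section {F : Type*} [NormedAddCommGroup F] [NormedSpace ℝ F] {V : M → Type*}
    [TopologicalSpace (TotalSpace F V)] [∀ x, TopologicalSpace (V x)] [FiberBundle F V]
    [∀ x, AddCommMonoid (V x)] [∀ x, Module ℝ (V x)] [VectorBundle ℝ F V]
    [ContMDiffVectorBundle ∞ F V 𝓘(ℝ, E)]
    {s : ∀ x, V x} (hs : ContMDiff 𝓘(ℝ, E) (𝓘(ℝ, E).prod 𝓘(ℝ, F)) ∞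
      fun x => (⟨x, s x⟩ : TotalSpace F V)) (x₀ : M) {p : E}
    (hp : p ∈ (extChartAt 𝓘(ℝ, E) x₀).target)
    (hb : (extChartAt 𝓘(ℝ, E) x₀).symm p ∈ (trivializationAt F V x₀).baseSet) :
    ContDiffAt ℝ ∞ (fun q => (trivializationAt F V x₀ ⟨(extChartAt 𝓘(ℝ, E) x₀).symm q,
      s ((extChartAt 𝓘(ℝ, E) x₀).symm q)⟩).2) p := by
  have h1 := ((trivializationAt F V x₀).contMDiffAt_section_iff hb).mp (hs _)
  have h2 : ContMDiffAt 𝓘(ℝ, E) 𝓘(ℝ, E) ∞ (extChartAt 𝓘(ℝ, E) x₀).symm p :=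
    (contMDiffOn_extChartAt_symm x₀).contMDiffAt ((isOpen_extChartAt_target x₀).mem_nhds hp)
  exact (h1.comp p h2).contDiffAt

theorem contDiffAt_coordVec {ξ : ∀ x : M, TangentSpace 𝓘(ℝ, E) x}
    (hξ : ContMDiff 𝓘(ℝ, E) (𝓘(ℝ, E).prod 𝓘(ℝ, E)) ∞
      (fun x => (⟨x, ξ x⟩ : TotalSpace E (fun x : M => TangentSpace 𝓘(ℝ, E) x))))
    (x₀ : M) {p : E} (hp : p ∈ (extChartAt 𝓘(ℝ, E) x₀).target) :
    ContDiffAt ℝ ∞ (coordVec x₀ ξ) p := by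
  refine (contDiffAt_section hξ x₀ hp (symm_mem_baseSet x₀ hp)).congr_of_eventuallyEq ?_
  filter_upwards [(isOpen_extChartAt_target (I := 𝓘(ℝ, E)) x₀).mem_nhds hp] with q hq
  rw [coordVec, chartPush_eq x₀ hq]
  exact Trivialization.continuousLinearMapAt_apply_of_mem _ _ (symm_mem_baseSet x₀ hq) _

theorem contDiffAt_coordEnd
    {φ : ∀ x : M, TangentSpace 𝓘(ℝ, E) x →L[ℝ] TangentSpace 𝓘(ℝ, E) x}
    (hφ : ContMDiff 𝓘(ℝ, E) (𝓘(ℝ, E).prod 𝓘(ℝ, E →L[ℝ] E)) ∞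
      (fun x => (⟨x, φ x⟩ : TotalSpace (E →L[ℝ] E)
        (fun x : M => TangentSpace 𝓘(ℝ, E) x →L[ℝ] TangentSpace 𝓘(ℝ, E) x))))
    (x₀ : M) {p : E} (hp : p ∈ (extChartAt 𝓘(ℝ, E) x₀).target) :
    ContDiffAt ℝ ∞ (coordEnd x₀ φ) p := by
  refine (contDiffAt_section hφ x₀ hp ⟨symm_mem_baseSet x₀ hp,
    symm_mem_baseSet x₀ hp⟩).congr_of_eventuallyEq ?_
  filter_upwards [(isOpen_extChartAt_target (I := 𝓘(ℝ, E)) x₀).mem_nhds hp] with q hq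
  rw [coordEnd, chartPush_eq x₀ hq, chartPull_eq x₀ hq]
  rfl

theorem contDiffAt_coordForm {η : ∀ x : M, TangentSpace 𝓘(ℝ, E) x →L[ℝ] ℝ}
    (hη : ContMDiff 𝓘(ℝ, E) (𝓘(ℝ, E).prod 𝓘(ℝ, E →L[ℝ] ℝ)) ∞
      (fun x => (⟨x, η x⟩ : TotalSpace (E →L[ℝ] ℝ)
        (fun x : M => TangentSpace 𝓘(ℝ, E) x →L[ℝ] ℝ))))
    (x₀ : M) {p : E} (hp : p ∈ (extChartAt 𝓘(ℝ, E) x₀).target) :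
    ContDiffAt ℝ ∞ (coordForm x₀ η) p := by
  refine (contDiffAt_section hη x₀ hp ⟨symm_mem_baseSet x₀ hp,
    Set.mem_univ _⟩).congr_of_eventuallyEq ?_
  filter_upwards [(isOpen_extChartAt_target (I := 𝓘(ℝ, E)) x₀).mem_nhds hp] with q hq
  rw [coordForm, chartPull_eq x₀ hq, hom_trivializationAt_apply]
  ext v
  simp [ContinuousLinearMap.inCoordinates]
  rfl

theorem contDiffAt_coordBilin
    {g : ∀ x : M, TangentSpace 𝓘(ℝ, E) x →L[ℝ] TangentSpace 𝓘(ℝ, E) x →L[ℝ] ℝ}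
    (hg : ContMDiff 𝓘(ℝ, E) (𝓘(ℝ, E).prod 𝓘(ℝ, E →L[ℝ] E →L[ℝ] ℝ)) ∞
      (fun x => (⟨x, g x⟩ : TotalSpace (E →L[ℝ] E →L[ℝ] ℝ)
        (fun x : M => TangentSpace 𝓘(ℝ, E) x →L[ℝ] TangentSpace 𝓘(ℝ, E) x →L[ℝ] ℝ))))
    (x₀ : M) {p : E} (hp : p ∈ (extChartAt 𝓘(ℝ, E) x₀).target) :
    ContDiffAt ℝ ∞ (coordBilin x₀ g) p := by
  refine (contDiffAt_section hg x₀ hp ⟨symm_mem_baseSet x₀ hp, symm_mem_baseSet x₀ hp,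
    Set.mem_univ _⟩).congr_of_eventuallyEq ?_
  filter_upwards [(isOpen_extChartAt_target (I := 𝓘(ℝ, E)) x₀).mem_nhds hp] with q hq
  ext u v
  rw [coordBilin_apply, chartPull_eq x₀ hq, hom_trivializationAt_apply]
  rw [inCoordinates_apply_eq₂ (symm_mem_baseSet x₀ hq) (symm_mem_baseSet x₀ hq) (Set.mem_univ _)]
  rw [← Trivialization.symmL_apply (R := ℝ) _ (symm_mem_baseSet x₀ hq),
    ← Trivialization.symmL_apply (R := ℝ) _ (symm_mem_baseSet x₀ hq)]
  simp

variable {ε₀ ε₁ : ℝ}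

/-- The coordinate expressions of a (para)contact metric structure on `M` form a (para)contact
metric structure on the target of the chart. -/
theorem isParacontactOn_chart (S : AlmostParacontactMetric E M ε₀ ε₁)
    (hS : S.IsParacontactMetric) (x₀ : M) :
    IsParacontactOn (extChartAt 𝓘(ℝ, E) x₀).target (coordBilin x₀ S.g) (coordEnd x₀ S.φ)
      (coordVec x₀ S.ξ) (coordForm x₀ S.η) ε₀ ε₁ where
  isOpen := isOpen_extChartAt_target x₀
  smooth p hp := contDiffAt_coordBilin S.smooth_g x₀ hp
  symm p hp u v := by rw [coordBilin_apply, S.g_symm, coordBilin_apply]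
  nondeg p hp u h := by
    have h1 : chartPull x₀ p u = 0 := S.g_nondeg _ _ fun v => by
      have := h (chartPush x₀ p v)
      rwa [coordBilin_apply, chartPull_chartPush x₀ hp] at this
    rw [← chartPush_chartPull x₀ hp u, h1, map_zero]
  smooth_φ p hp := contDiffAt_coordEnd S.smooth_φ x₀ hp
  smooth_ξ p hp := contDiffAt_coordVec S.smooth_ξ x₀ hp
  smooth_η p hp := contDiffAt_coordForm S.smooth_η x₀ hp
  sq₀ := by rcases S.ε₀_sign with h | h <;> simp [h]
  sq₁ := by rcases S.ε₁_sign with h | h <;> simp [h]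
  φ_sq p hp u := by
    simp only [coordEnd, coordVec, coordForm, ContinuousLinearMap.comp_apply,
      chartPull_chartPush x₀ hp, S.φ_sq, map_smul, map_sub, chartPush_chartPull x₀ hp]
  η_ξ p hp := by
    simp only [coordVec, coordForm, ContinuousLinearMap.comp_apply,
      chartPull_chartPush x₀ hp, S.η_ξ]
  g_φ p hp u v := by
    simp only [coordEnd, coordForm, ContinuousLinearMap.comp_apply, coordBilin_apply,
      chartPull_chartPush x₀ hp, S.g_φ]
  contact p hp u v := hS x₀ p hp u v

end Transfer

/-! ### Identification of the pointwise traces with the curvature invariants. -/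

section Invariants

set_option maxSynthPendingDepth 3

variable {E : Type*} [NormedAddCommGroup E] [NormedSpace ℝ E] [FiniteDimensional ℝ E]
  {U : Set E} {g : E → (E →L[ℝ] E →L[ℝ] ℝ)} {φ : E → (E →L[ℝ] E)}
  {ξ : E → E} {η : E → (E →L[ℝ] ℝ)} {ε₀ ε₁ : ℝ}

namespace IsParacontactOn

variable (S : IsParacontactOn U g φ ξ η ε₀ ε₁) {p : E} (hp : p ∈ U)
include S hp

theorem coord_eq (i) (v : E) : (Module.finBasis ℝ E).coord i v =
    g p ((g p).inverse (LinearMap.toContinuousLinearMap ((Module.finBasis ℝ E).coord i))) v := by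
  rw [(isInvertible_of_nondeg (S.nondeg p hp)).self_apply_inverse]; rfl

theorem half_lieDer_eq : (1 / 2 : ℝ) • lieDer ξ φ p =
    φ p ∘L symmPart (φ p) (covVec (christoffelL g) ξ p) ε₀ := by
  ext v
  rw [ContinuousLinearMap.comp_apply, ← (S.firstOrder hp).half_lieDer_eq (S.dualPair hp)]
  simp only [lieDer, smul_apply, add_apply, sub_apply, ContinuousLinearMap.comp_apply,
    covEnd_apply, covVec_apply, cov, map_add, S.christoffel_symm hp (ξ p)]
  congr 1
  abel

theorem normSqEnd_eq : normSqEnd (g p) ((1 / 2 : ℝ) • lieDer ξ φ p) =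
    LinearMap.trace ℝ E (((1 / 2 : ℝ) • lieDer ξ φ p).comp ((1 / 2 : ℝ) • lieDer ξ φ p) :
      E →L[ℝ] E) := by
  rw [S.half_lieDer_eq hp]
  refine ((S.firstOrder hp).normSq_eq (S.dualPair hp)).trans ?_
  rw [LinearMap.trace_eq_matrix_trace ℝ (Module.finBasis ℝ E), Matrix.trace]
  refine Finset.sum_congr rfl fun i _ => ?_
  rw [Matrix.diag_apply, LinearMap.toMatrix_apply, ← Module.Basis.coord_apply, S.coord_eq hp,
    S.symm p hp]
  rfl

theorem ricci_ξ_ξ : ricci g p (ξ p) (ξ p) =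
    -ε₁ * (Module.finrank ℝ E - 1 - normSqEnd (g p) ((1 / 2 : ℝ) • lieDer ξ φ p)) := by
  have h := (S.secondOrder hp).ricci_ξ_eq (S.firstOrder hp) (S.dualPair hp)
    (by rw [sum_finBasis (S.symm p hp) (S.nondeg p hp)]; ring)
  rw [S.half_lieDer_eq hp, ricci]
  simp only [S.coord_eq hp]
  exact h

theorem starScalarCurv_add : starScalarCurv g φ p + ε₁ * scalarCurv g p =
    ε₀ * ε₁ * ricci g p (ξ p) (ξ p) - ε₀ * (Module.finrank ℝ E - 1) ^ 2 +
      1 / 2 * traceCovDerSq g φ p := by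
  have h := (S.secondOrder hp).scalar_add (S.firstOrder hp) (S.dualPair hp)
    (by rw [sum_finBasis (S.symm p hp) (S.nondeg p hp)]; ring)
  simp only [starScalarCurv, scalarCurv, metricTrace, starRicci, ricci, S.coord_eq hp]
  exact h

end IsParacontactOn

end Invariants

end Paracontact

/-! ### Assembly in the chart at `x`. -/

theorem mainTheorem8 (n : ℕ) {M : Type*} [TopologicalSpace M]
    [ChartedSpace (EuclideanSpace ℝ (Fin (2 * n + 1))) M]
    [IsManifold (𝓡 (2 * n + 1)) ∞ M] {ε₀ ε₁ : ℝ}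
    (S : Paracontact.AlmostParacontactMetric (EuclideanSpace ℝ (Fin (2 * n + 1))) M ε₀ ε₁)
    (hS : S.IsParacontactMetric) (x : M) :
    S.ricciXi x = -ε₁ * (2 * (n : ℝ) - S.normHSq x) ∧
      ε₀ * (S.starScalar x + ε₁ * S.scalar x) + 4 * (n : ℝ) ^ 2 =
        S.traceHSq x + 1 / 2 * (ε₀ * S.traceNablaPhiSq x - 4 * (n : ℝ)) := by
  have T := Paracontact.isParacontactOn_chart S hS x
  have hp := mem_extChartAt_target (I := 𝓡 (2 * n + 1)) x
  have hdim : (Module.finrank ℝ (EuclideanSpace ℝ (Fin (2 * n + 1))) : ℝ) - 1 = 2 * n := by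
    simp
  have h1 := T.ricci_ξ_ξ hp
  have h2 := T.starScalarCurv_add hp
  have h3 := T.normSqEnd_eq hp
  rw [hdim] at h1 h2
  change S.ricciXi x = -ε₁ * (2 * (n : ℝ) - S.normHSq x) at h1
  change S.normHSq x = S.traceHSq x at h3
  change S.starScalar x + ε₁ * S.scalar x = ε₀ * ε₁ * S.ricciXi x - ε₀ * (2 * (n : ℝ)) ^ 2 +
    1 / 2 * S.traceNablaPhiSq x at h2
  refine ⟨h1, ?_⟩
  rw [h2, h1, ← h3]
  -- With both signs squaring to one, the Ric(ξ,ξ) term becomes |h|² - 2n, which supplies both Tr h²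
  -- and the -4n inside the half.
  linear_combination (-(ε₁ * ε₁ * (2 * (n : ℝ) - S.normHSq x)) - (2 * (n : ℝ)) ^ 2) * T.sq₀ -
    (2 * (n : ℝ) - S.normHSq x) * T.sq₁
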